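/- Theorem 2.5. Let $q\ge 2$ and $N$ be integers. For $n\ge 0$ let $S((\mathbb C^q)^{\otimes n})$ be the set of density matrices (positive semidefinite, trace $1$) on $n$ qudits of dimension $q$. A quantum channel is a completely positive trace-preserving linear map. A subspace $\mathcal C\subseteq(\mathbb C^q)^{\otimes N}$ corrects a map $\Phi$ from operators on $N$ qudits to operators on $N'$ qudits if there is a quantum channel $\mathcal R$, from operators on $N'$ qudits to operators on $N$ qudits, with $\mathcal R(\Phi(\rho))=\rho$ for every density matrix $\rho$ supported on $\mathcal C$. For a set $P=\{p_1<\dots<p_t\}\subseteq\{1,\dots,n+t\}$ and a product state $\sigma=\sigma_1\otimes\dots\otimes\sigma_t$ with $\sigma_i\in S(\mathbb C^q)$, let $\mathrm{Ins}_{P,\sigma}$ be the map from $n$ to $n+t$ qudits that inserts $\sigma_1$ as tensor factor number $p_1$, then $\sigma_2$ as tensor factor number $p_2$, and so on up to $\sigma_t$; let $\mathrm{Era}_P$ be the map from $n+t$ to $n$ qudits that traces out the tensor factors $p_t,\dots,p_1$. A $t$-insertion channel on $n$ qudits is a map $$\rho\mapsto\int\sum_{|P|=t}p_\sigma(P)\,\mathrm{Ins}_{P,\sigma}(\rho)\,d\mu(\sigma),$$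 where $\mu$ is a Borel probability measure on the product states $\sigma$ of $t$ qudits and, for each $\sigma$, $p_\sigma$ is a probability distribution on the $t$-element subsets $P$ of $\{1,\dots,n+t\}$, depending measurably on $\sigma$. A $t$-deletion channel on $n+t$ qudits is a map $\rho\mapsto\sum_{|P|=t}p(P)\,\mathrm{Era}_P(\rho)$, where $p$ is a probability distribution on those subsets. For $t=0$ both are the identity. For $t_2<N$, a $(t_1,t_2)$-insdel channel on $N$ qudits is a $t_2$-deletion channel on $N$ qudits followed by a $t_1$-insertion channel on $N-t_2$ qudits. A subspace $\mathcal C\subseteq(\mathbb C^q)^{\otimes N}$ is a $(t_1,t_2)$-insdel code if it corrects every $(t_1,t_2)$-insdel channel on $N$ qudits. Let $t_1,t_2,s_1,s_2$ be non-negative integers with $t_2<N$, $s_2<N$ and $t_1+t_2=s_1+s_2$. Then every $(t_1,t_2)$-insdel code $\mathcal C\subseteq(\mathbb C^q)^{\otimes N}$ is an $(s_1,s_2)$-insdel code. -/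

import Mathlib

open MeasureTheory
open scoped ComplexOrder

noncomputable section

namespace Insdel

/-- Operators on `n` qudits of local dimension `q`: complex matrices of order `q ^ n`, with rows and
columns indexed by the strings `x : Fin n → Fin q` that label the standard basis. -/
abbrev Op (q n : ℕ) : Type := Matrix (Fin n → Fin q) (Fin n → Fin q) ℂ

/-- Density matrices: positive semidefinite Hermitian matrices of trace `1`. -/
def IsDensity {ι : Type*} [Fintype ι] (M : Matrix ι ι ℂ) : Prop :=
  M.PosSemidef ∧ M.trace = 1

/-- The space of one-qudit states. -/
abbrev QuditState (q : ℕ) : Type := {σ : Matrix (Fin q) (Fin q) ℂ // IsDensity σ}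

/-- The Borel structure of the space of one-qudit states: generated by the matrix entries. -/
instance (q : ℕ) : MeasurableSpace (QuditState q) :=
  MeasurableSpace.comap (fun σ (ij : Fin q × Fin q) => σ.1 ij.1 ij.2) inferInstance

/-! ### Quantum channels and error correction -/

/-- The map `Φ ⊗ id` on matrices over `ι × Fin k`: apply `Φ` to every block. -/
def ampliation {ι κ : Type*} (k : ℕ) (Φ : Matrix ι ι ℂ →ₗ[ℂ] Matrix κ κ ℂ)
    (X : Matrix (ι × Fin k) (ι × Fin k) ℂ) : Matrix (κ × Fin k) (κ × Fin k) ℂ :=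
  Matrix.of fun u v => Φ (Matrix.of fun i j => X (i, u.2) (j, v.2)) u.1 v.1

/-- Quantum channels: completely positive and trace-preserving linear maps. -/
def IsQuantumChannel {ι κ : Type*} [Fintype ι] [Fintype κ]
    (Φ : Matrix ι ι ℂ →ₗ[ℂ] Matrix κ κ ℂ) : Prop :=
  (∀ (k : ℕ) (X : Matrix (ι × Fin k) (ι × Fin k) ℂ),
      X.PosSemidef → (ampliation k Φ X).PosSemidef) ∧
    ∀ X : Matrix ι ι ℂ, (Φ X).trace = X.trace

/-- `ρ` is supported on the subspace `C`: its range is contained in `C`. -/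
def SupportedOn {ι : Type*} [Fintype ι] (C : Submodule ℂ (ι → ℂ)) (ρ : Matrix ι ι ℂ) : Prop :=
  ∀ v : ι → ℂ, ρ.mulVec v ∈ C

/-- The code `C` corrects the errors introduced by `Φ`: one recovery channel restores every density
matrix supported on `C`. -/
def Corrects {ι κ : Type*} [Fintype ι] [Fintype κ] (C : Submodule ℂ (ι → ℂ))
    (Φ : Matrix ι ι ℂ → Matrix κ κ ℂ) : Prop :=
  ∃ R : Matrix κ κ ℂ →ₗ[ℂ] Matrix ι ι ℂ, IsQuantumChannel R ∧
    ∀ ρ : Matrix ι ι ℂ, IsDensity ρ → SupportedOn C ρ → R (Φ ρ) = ρ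

/-! ### Inserting and tracing out single qudits -/

/-- Insert the one-qudit operator `σ` as tensor factor number `p` (counted from `0`). -/
def insertAt {q n : ℕ} (p : Fin (n + 1)) (σ : Matrix (Fin q) (Fin q) ℂ) (M : Op q n) :
    Op q (n + 1) :=
  Matrix.of fun x y => σ (x p) (y p) * M (p.removeNth x) (p.removeNth y)

/-- The partial trace over tensor factor number `p` (counted from `0`). -/
def traceAt {q n : ℕ} (p : Fin (n + 1)) (M : Op q (n + 1)) : Op q n :=
  Matrix.of fun x y => ∑ a : Fin q,
    M (Fin.insertNth (α := fun _ => Fin q) p a x) (Fin.insertNth (α := fun _ => Fin q) p a y)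

/-- The sets of `t` positions among `n + t` positions. -/
abbrev PosSet (n t : ℕ) : Type := {P : Finset (Fin (n + t)) // P.card = t}

theorem orderEmbOfFin_lt {n t : ℕ} (P : PosSet n t) (i : Fin t) :
    (P.1.orderEmbOfFin P.2 i : ℕ) < n + i + 1 := by
  have key : ∀ (k : ℕ) (hk : (i : ℕ) + k < t),
      (P.1.orderEmbOfFin P.2 i : ℕ) + k ≤ (P.1.orderEmbOfFin P.2 ⟨i + k, hk⟩ : ℕ) := by
    intro k
    induction k with
    | zero => intro hk; exact le_rfl
    | succ k ih =>
      intro hk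
      have h1 := ih (by omega)
      have h2 : P.1.orderEmbOfFin P.2 ⟨i + k, by omega⟩ < P.1.orderEmbOfFin P.2 ⟨i + (k + 1), hk⟩ :=
        (P.1.orderEmbOfFin P.2).strictMono (Fin.mk_lt_mk.2 (by omega))
      have h3 := Fin.lt_def.1 h2
      omega
  have h1 := key (t - 1 - i) (by omega)
  have h2 := (P.1.orderEmbOfFin P.2 ⟨i + (t - 1 - i), by omega⟩).isLt
  omega

/-- The `i`-th smallest element of `P`; it is a legitimate position among `n + i + 1` positions. -/
def PosSet.pos {n t : ℕ} (P : PosSet n t) (i : Fin t) : Fin (n + i + 1) :=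
  ⟨(P.1.orderEmbOfFin P.2 i : ℕ), orderEmbOfFin_lt P i⟩

/-- Insert `σ 0` at `p 0`, then `σ 1` at `p 1`, and so on. -/
def insertSeq {q n : ℕ} : (t : ℕ) → ((i : Fin t) → Fin (n + i + 1)) →
    (Fin t → Matrix (Fin q) (Fin q) ℂ) → Op q n → Op q (n + t)
  | 0, _, _, M => M
  | t + 1, p, σ, M => insertAt (n := n + t) (p (Fin.last t)) (σ (Fin.last t))
      (insertSeq t (fun i => p i.castSucc) (fun i => σ i.castSucc) M)

/-- Trace out the positions `p (t - 1)`, …, `p 1`, `p 0`, in this order. -/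
def traceSeq {q n : ℕ} : (t : ℕ) → ((i : Fin t) → Fin (n + i + 1)) → Op q (n + t) → Op q n
  | 0, _, M => M
  | t + 1, p, M => traceSeq t (fun i => p i.castSucc) (traceAt (n := n + t) (p (Fin.last t)) M)

/-- The insertion error with position set `P` and the product state `σ 0 ⊗ ⋯ ⊗ σ (t - 1)`: the
factors are inserted at the elements of `P` in increasing order. -/
def insertion {q n t : ℕ} (P : PosSet n t) (σ : Fin t → QuditState q) (M : Op q n) :
    Op q (n + t) :=
  insertSeq t P.pos (fun i => (σ i).1) M

/-- The erasure error with position set `P`: the elements of `P` are traced out in decreasing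
order. -/
def erasure {q n t : ℕ} (P : PosSet n t) (M : Op q (n + t)) : Op q n :=
  traceSeq t P.pos M

/-! ### Insertion, deletion and insdel channels -/

/-- `Φ` is a `t`-insertion channel on `n` qudits: the average of the insertion errors over a
probability measure `μ` on the product states `σ 0 ⊗ ⋯ ⊗ σ (t - 1)` (given by their factors) and,
for each of them, a probability distribution `p σ` on the position sets. The integral of matrices is
taken entrywise. -/
def IsInsertionChannel {q : ℕ} (n t : ℕ) (Φ : Op q n → Op q (n + t)) : Prop :=
  ∃ (μ : Measure (Fin t → QuditState q)) (p : (Fin t → QuditState q) → PosSet n t → ℝ),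
    IsProbabilityMeasure μ ∧ (∀ P, Measurable fun σ => p σ P) ∧ (∀ σ P, 0 ≤ p σ P) ∧
    (∀ σ, ∑ P, p σ P = 1) ∧
    ∀ (M : Op q n) (x y : Fin (n + t) → Fin q),
      Φ M x y = ∫ σ, ∑ P, (p σ P : ℂ) * insertion P σ M x y ∂μ

/-- `Φ` is a `t`-deletion channel on `n + t` qudits: a convex combination of the erasure errors. -/
def IsDeletionChannel {q : ℕ} (n t : ℕ) (Φ : Op q (n + t) → Op q n) : Prop :=
  ∃ p : PosSet n t → ℝ, (∀ P, 0 ≤ p P) ∧ ∑ P, p P = 1 ∧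
    ∀ M : Op q (n + t), Φ M = ∑ P, (p P : ℂ) • erasure P M

/-- Identify operators on `m` and on `n` qudits when `m = n`. -/
def relabel {q m n : ℕ} (h : m = n) (M : Op q m) : Op q n :=
  M.submatrix (fun x => x ∘ Fin.cast h) (fun y => y ∘ Fin.cast h)

/-- `Φ` is a `(t₁, t₂)`-insdel channel on `N` qudits: a `t₂`-deletion channel followed by a
`t₁`-insertion channel. -/
def IsInsdelChannel {q : ℕ} (N t₁ t₂ : ℕ) (h : t₂ < N) (Φ : Op q N → Op q (N - t₂ + t₁)) : Prop :=
  ∃ (del : Op q (N - t₂ + t₂) → Op q (N - t₂)) (ins : Op q (N - t₂) → Op q (N - t₂ + t₁)),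
    IsDeletionChannel (N - t₂) t₂ del ∧ IsInsertionChannel (N - t₂) t₁ ins ∧
    ∀ M : Op q N, Φ M = ins (del (relabel (Nat.sub_add_cancel h.le).symm M))

/-- The subspace `C` of the `N`-qudit space is a `(t₁, t₂)`-insdel code: it corrects every
`(t₁, t₂)`-insdel channel. -/
def IsInsdelCode {q N : ℕ} (C : Submodule ℂ ((Fin N → Fin q) → ℂ)) (t₁ t₂ : ℕ) (h : t₂ < N) :
    Prop :=
  ∀ Φ : Op q N → Op q (N - t₂ + t₁), IsInsdelChannel N t₁ t₂ h Φ → Corrects C Φ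

end Insdel

end

noncomputable section

namespace Insdel

open Matrix

/-! Whether a code corrects all `(t₁, t₂)`-insdel channels is a Knill-Laflamme condition on the
products `Eᴴ * E'` of their Kraus operators. These may be taken to be `t₂` adjoints of basis-vector
insertions followed by `t₁` insertions, so `Eᴴ * E'` is a word: `t₂` insertions, `t₁` deletions,
`t₁` insertions, `t₂` deletions, read as a matrix product from left to right. The condition is that
all these words lie in `scalarOn C`, which is a linear subspace.

A deletion and an insertion at different positions commute up to a shift of positions. At equal
positions the deletion of an insertion is `0` or `1`, and on at least one qudit `1` is a sum of
insertions after deletions. Hence a subspace contains all words of a given shape exactly when it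
contains those with an adjacent insertion and deletion exchanged. Moving one insertion to the left
and one deletion to the right turns `(t₁ + 1, t₂)` into `(t₁, t₂ + 1)`, so only `t₁ + t₂` matters
(`wordIn_insdelWord_iff_zero`).

Two bridges remain. `wordIn_scalarOn_of_forall_corrects` extracts the condition from a single
channel, which has every product of sorted insertions and deletions among its Kraus operators;
unsorted products reduce to sorted ones. `corrects_of_wordIn_scalarOn` builds one recovery for the
whole span of errors, which then serves every mixture, including integrals over inserted states. -/

/-! ### Insertion of basis vectors -/

/-- The isometry inserting the basis vector `a` as tensor factor number `p`. -/
def insMat {q n : ℕ} (p : Fin (n + 1)) (a : Fin q) :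
    Matrix (Fin (n + 1) → Fin q) (Fin n → Fin q) ℂ :=
  Matrix.of fun x y => if x = Fin.insertNth (α := fun _ => Fin q) p a y then 1 else 0

theorem conjTranspose_insMat_apply {q n : ℕ} (p : Fin (n + 1)) (a : Fin q)
    (y : Fin n → Fin q) (x : Fin (n + 1) → Fin q) :
    (insMat p a)ᴴ y x = if x = Fin.insertNth (α := fun _ => Fin q) p a y then 1 else 0 := by
  simp only [insMat, conjTranspose_apply, of_apply]
  split_ifs <;> simp

theorem mul_insMat_apply {q n : ℕ} {κ : Type*} (p : Fin (n + 1)) (a : Fin q)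
    (M : Matrix κ (Fin (n + 1) → Fin q) ℂ) (x : κ) (y : Fin n → Fin q) :
    (M * insMat p a) x y = M x (Fin.insertNth (α := fun _ => Fin q) p a y) := by
  simp [insMat, mul_apply]

theorem conjTranspose_insMat_mul_apply {q n : ℕ} {κ : Type*} (p : Fin (n + 1)) (a : Fin q)
    (M : Matrix (Fin (n + 1) → Fin q) κ ℂ) (x : Fin n → Fin q) (y : κ) :
    ((insMat p a)ᴴ * M) x y = M (Fin.insertNth (α := fun _ => Fin q) p a x) y := by
  rw [mul_apply]
  simp only [conjTranspose_insMat_apply]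
  simp

theorem eq_insertNth_iff_and {q n : ℕ} (p : Fin (n + 1)) (a : Fin q)
    (x : Fin (n + 1) → Fin q) (y : Fin n → Fin q) :
    x = Fin.insertNth (α := fun _ => Fin q) p a y ↔ a = x p ∧ y = p.removeNth x := by
  rw [Fin.eq_insertNth_iff]
  exact and_congr eq_comm eq_comm

theorem insMat_mul_apply {q n : ℕ} {κ : Type*} (p : Fin (n + 1)) (a : Fin q)
    (M : Matrix (Fin n → Fin q) κ ℂ) (x : Fin (n + 1) → Fin q) (y : κ) :
    (insMat p a * M) x y = if a = x p then M (p.removeNth x) y else 0 := by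
  simp only [insMat, mul_apply, of_apply, eq_insertNth_iff_and]
  by_cases h : a = x p <;> simp [h]

theorem mul_conjTranspose_insMat_apply {q n : ℕ} {κ : Type*} (p : Fin (n + 1)) (a : Fin q)
    (M : Matrix κ (Fin n → Fin q) ℂ) (x : κ) (y : Fin (n + 1) → Fin q) :
    (M * (insMat p a)ᴴ) x y = if a = y p then M x (p.removeNth y) else 0 := by
  simp only [mul_apply, conjTranspose_insMat_apply, eq_insertNth_iff_and]
  by_cases h : a = y p <;> simp [h]

theorem conjTranspose_insMat_mul_insMat {q n : ℕ} (p : Fin (n + 1)) (a b : Fin q) :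
    (insMat p a)ᴴ * insMat p b =
      if a = b then (1 : Matrix (Fin n → Fin q) (Fin n → Fin q) ℂ) else 0 := by
  ext x y
  rw [conjTranspose_insMat_mul_apply]
  simp only [insMat, of_apply, Fin.insertNth_inj]
  split_ifs <;> simp_all [one_apply]

theorem sum_insMat_mul_conjTranspose {q n : ℕ} (p : Fin (n + 1)) :
    ∑ a : Fin q, insMat p a * (insMat p a)ᴴ =
      (1 : Matrix (Fin (n + 1) → Fin q) (Fin (n + 1) → Fin q) ℂ) := by
  ext x y
  rw [Matrix.sum_apply]
  simp only [insMat_mul_apply, Finset.sum_ite_eq', Finset.mem_univ, if_true,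
    conjTranspose_insMat_apply, one_apply]
  congr 1
  rw [eq_insertNth_iff_and, eq_iff_iff]
  constructor
  · rintro ⟨h1, h2⟩
    funext i
    rcases Fin.eq_self_or_eq_succAbove p i with rfl | ⟨j, rfl⟩
    · exact h1
    · exact congrFun h2 j
  · rintro rfl
    exact ⟨rfl, rfl⟩

/-- Both sides carry `a` at `p` and `b` at `r + 1`: if `b` enters first, at `r`, the later insertion
at `p ≤ r` pushes it one place to the right. Equality `p = r` is allowed. -/
theorem insertNth_succ_insertNth {n : ℕ} {α : Type*} {p r : Fin (n + 1)} (h : p ≤ r) (a b : α)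
    (z : Fin n → α) :
    Fin.insertNth (α := fun _ => α) r.succ b (Fin.insertNth (α := fun _ => α) p a z) =
      Fin.insertNth (α := fun _ => α) p.castSucc a (Fin.insertNth (α := fun _ => α) r b z) := by
  have h1 : p.castSucc.succAbove r = r.succ :=
    Fin.succAbove_of_le_castSucc _ _ (Fin.castSucc_le_castSucc_iff.2 h)
  have h2 : r.succ.succAbove p = p.castSucc :=
    Fin.succAbove_of_castSucc_lt _ _ (Fin.castSucc_lt_succ_iff.2 h)
  have h3 : ∀ j : Fin n,
      r.succ.succAbove (p.succAbove j) = p.castSucc.succAbove (r.succAbove j) := by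
    intro j
    ext
    simp only [Fin.succAbove, Fin.lt_def]
    simp only [Fin.le_def] at h
    split_ifs <;> simp_all <;> omega
  rw [Fin.insertNth_eq_iff]
  constructor
  · conv_rhs => rw [← h1, Fin.insertNth_apply_succAbove, Fin.insertNth_apply_same]
  · funext i
    change _ = Fin.insertNth (α := fun _ => α) p.castSucc a (Fin.insertNth (α := fun _ => α) r b z)
      (r.succ.succAbove i)
    rcases Fin.eq_self_or_eq_succAbove p i with rfl | ⟨j, rfl⟩
    · rw [h2, Fin.insertNth_apply_same, Fin.insertNth_apply_same]
    · rw [h3, Fin.insertNth_apply_succAbove, Fin.insertNth_apply_succAbove,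
        Fin.insertNth_apply_succAbove]

theorem insMat_succ_mul_insMat {q n : ℕ} {p r : Fin (n + 1)} (h : p ≤ r) (a b : Fin q) :
    insMat r.succ b * insMat p a = insMat p.castSucc a * insMat r b := by
  ext x y
  rw [mul_insMat_apply, mul_insMat_apply]
  simp only [insMat, of_apply, insertNth_succ_insertNth h]

/-- Follows from the commutation of two insertions: put the resolution of the identity at `p` on the
right, commute, and orthogonality keeps only the term `c = a`. -/
theorem conjTranspose_insMat_castSucc_mul_insMat_succ {q n : ℕ} {p r : Fin (n + 1)} (h : p ≤ r)
    (a b : Fin q) :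
    (insMat p.castSucc a)ᴴ * insMat r.succ b = insMat r b * (insMat p a)ᴴ := by
  calc (insMat p.castSucc a)ᴴ * insMat r.succ b
      = (insMat p.castSucc a)ᴴ * insMat r.succ b * ∑ c : Fin q, insMat p c * (insMat p c)ᴴ := by
        rw [sum_insMat_mul_conjTranspose, Matrix.mul_one]
    _ = ∑ c : Fin q, ((insMat p.castSucc a)ᴴ * insMat p.castSucc c) *
          (insMat r b * (insMat p c)ᴴ) := by
        rw [Finset.mul_sum]
        refine Finset.sum_congr rfl fun c _ => ?_
        rw [Matrix.mul_assoc, ← Matrix.mul_assoc (insMat r.succ b), insMat_succ_mul_insMat h]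
        simp only [Matrix.mul_assoc]
    _ = insMat r b * (insMat p a)ᴴ := by
        simp [conjTranspose_insMat_mul_insMat]

theorem conjTranspose_insMat_succ_mul_insMat_castSucc {q n : ℕ} {p r : Fin (n + 1)} (h : p ≤ r)
    (a b : Fin q) :
    (insMat r.succ b)ᴴ * insMat p.castSucc a = insMat p a * (insMat r b)ᴴ := by
  have := congrArg conjTranspose (conjTranspose_insMat_castSucc_mul_insMat_succ h a b)
  simpa using this

/-! ### Products of insertions and deletions -/

/-- `A` is a product of insertions of basis vectors and their adjoints, whose order is prescribed
by the word `w`: `true` is an insertion, `false` an adjoint, and the last letter acts first. -/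
inductive IsMonomial {q : ℕ} : List Bool → (m n : ℕ) →
    Matrix (Fin m → Fin q) (Fin n → Fin q) ℂ → Prop
  | nil (n : ℕ) : IsMonomial [] n n 1
  | ins {w : List Bool} {m n : ℕ} {A : Matrix (Fin m → Fin q) (Fin n → Fin q) ℂ}
      (p : Fin (m + 1)) (a : Fin q) (hA : IsMonomial w m n A) :
      IsMonomial (true :: w) (m + 1) n (insMat p a * A)
  | del {w : List Bool} {m n : ℕ} {A : Matrix (Fin (m + 1) → Fin q) (Fin n → Fin q) ℂ}
      (p : Fin (m + 1)) (a : Fin q) (hA : IsMonomial w (m + 1) n A) :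
      IsMonomial (false :: w) m n ((insMat p a)ᴴ * A)

namespace IsMonomial

variable {q : ℕ}

/-- Qudit count, written without subtraction. It shows that the exchange of letters takes place on
at least one qudit, and it identifies the intermediate sizes when a word is split. -/
theorem level {w : List Bool} {m n : ℕ} {A : Matrix (Fin m → Fin q) (Fin n → Fin q) ℂ}
    (h : IsMonomial w m n A) : m + w.count false = n + w.count true := by
  induction h with
  | nil n => simp
  | ins p a hA ih => simp; omega
  | del p a hA ih => simp; omega

theorem append {u v : List Bool} {m k n : ℕ} {A : Matrix (Fin m → Fin q) (Fin k → Fin q) ℂ}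
    {B : Matrix (Fin k → Fin q) (Fin n → Fin q) ℂ} (hA : IsMonomial u m k A)
    (hB : IsMonomial v k n B) : IsMonomial (u ++ v) m n (A * B) := by
  induction hA with
  | nil n => simpa using hB
  | ins p a hA ih => rw [Matrix.mul_assoc]; exact ins p a (ih hB)
  | del p a hA ih => rw [Matrix.mul_assoc]; exact del p a (ih hB)

theorem exists_of_append {u v : List Bool} {m n : ℕ}
    {A : Matrix (Fin m → Fin q) (Fin n → Fin q) ℂ} (h : IsMonomial (u ++ v) m n A) :
    ∃ (k : ℕ) (B : Matrix (Fin m → Fin q) (Fin k → Fin q) ℂ)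
      (D : Matrix (Fin k → Fin q) (Fin n → Fin q) ℂ),
      IsMonomial u m k B ∧ IsMonomial v k n D ∧ A = B * D := by
  induction u generalizing m with
  | nil => exact ⟨m, 1, A, nil m, h, (Matrix.one_mul A).symm⟩
  | cons c u ih =>
    cases h with
    | ins p a hA =>
      obtain ⟨k, B, D, hB, hD, rfl⟩ := ih hA
      exact ⟨k, _, D, ins p a hB, hD, (Matrix.mul_assoc _ _ _).symm⟩
    | del p a hA =>
      obtain ⟨k, B, D, hB, hD, rfl⟩ := ih hA
      exact ⟨k, _, D, del p a hB, hD, (Matrix.mul_assoc _ _ _).symm⟩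

theorem ins_single {n : ℕ} (p : Fin (n + 1)) (a : Fin q) :
    IsMonomial [true] (n + 1) n (insMat p a) := by
  simpa using ins p a (nil n)

theorem del_single {n : ℕ} (p : Fin (n + 1)) (a : Fin q) :
    IsMonomial [false] n (n + 1) (insMat p a)ᴴ := by
  simpa using del p a (nil (n + 1))

theorem conjTranspose_replicate_true {t m n : ℕ}
    {A : Matrix (Fin m → Fin q) (Fin n → Fin q) ℂ}
    (h : IsMonomial (List.replicate t true) m n A) :
    IsMonomial (List.replicate t false) n m Aᴴ := by
  induction t generalizing m with
  | zero => cases h with | nil => simpa using nil n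
  | succ t ih =>
    rw [List.replicate_succ] at h
    cases h with
    | ins p a hA =>
      rw [conjTranspose_mul, List.replicate_succ']
      exact (ih hA).append (del_single p a)

theorem conjTranspose_replicate_false {t m n : ℕ}
    {A : Matrix (Fin m → Fin q) (Fin n → Fin q) ℂ}
    (h : IsMonomial (List.replicate t false) m n A) :
    IsMonomial (List.replicate t true) n m Aᴴ := by
  induction t generalizing m with
  | zero => cases h with | nil => simpa using nil n
  | succ t ih =>
    rw [List.replicate_succ] at h
    cases h with
    | del p a hA =>
      rw [conjTranspose_mul, conjTranspose_conjTranspose, List.replicate_succ']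
      exact (ih hA).append (ins_single p a)

end IsMonomial

/-! ### Exchanging insertions and deletions -/

/-- All products prescribed by the word `w` lie in the subspace `G`. -/
def WordIn {q m n : ℕ} (G : Submodule ℂ (Matrix (Fin m → Fin q) (Fin n → Fin q) ℂ))
    (w : List Bool) : Prop :=
  ∀ A, IsMonomial w m n A → A ∈ G

namespace WordIn

variable {q m n : ℕ} {G : Submodule ℂ (Matrix (Fin m → Fin q) (Fin n → Fin q) ℂ)}

/-- The hypothesis `hv` says that at least one qudit is left after `v` has acted. It is needed when
both positions agree, where the product may be the identity and must be resolved into insertions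
after deletions. -/
theorem del_ins_of_ins_del {u v : List Bool} (hv : v.count false < n + v.count true)
    (h : WordIn G (u ++ true :: false :: v)) : WordIn G (u ++ false :: true :: v) := by
  intro A hA
  obtain ⟨k, B, D, hB, hD, rfl⟩ := hA.exists_of_append
  cases hD with
  | del p a hD =>
  cases hD with
  | @ins _ _ _ D r b hD =>
  have hk := hD.level
  obtain ⟨k, rfl⟩ : ∃ l, k = l + 1 := ⟨k - 1, by omega⟩
  have key : ∀ (p' r' : Fin (k + 1)) (a' b' : Fin q),
      B * (insMat r' b' * ((insMat p' a')ᴴ * D)) ∈ G := fun p' r' a' b' =>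
    h _ (hB.append ((hD.del p' a').ins r' b'))
  rcases lt_trichotomy p r with hpr | rfl | hpr
  · obtain ⟨p, rfl⟩ := Fin.eq_castSucc_of_ne_last (Fin.ne_last_of_lt hpr)
    obtain ⟨r, rfl⟩ := Fin.exists_succ_eq_of_ne_zero (Fin.ne_zero_of_lt hpr)
    rw [← Matrix.mul_assoc (insMat p.castSucc a)ᴴ,
      conjTranspose_insMat_castSucc_mul_insMat_succ (Fin.castSucc_lt_succ_iff.1 hpr),
      Matrix.mul_assoc]
    exact key _ _ _ _
  · rw [← Matrix.mul_assoc (insMat p a)ᴴ, conjTranspose_insMat_mul_insMat]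
    split_ifs
    -- Any position would do for the resolution of the identity; `0` exists because a qudit is left.
    · rw [← sum_insMat_mul_conjTranspose (q := q) (0 : Fin (k + 1)), Matrix.sum_mul,
        Matrix.mul_sum]
      refine Submodule.sum_mem _ fun c _ => ?_
      rw [Matrix.mul_assoc]
      exact key _ _ _ _
    · simp
  · obtain ⟨r, rfl⟩ := Fin.eq_castSucc_of_ne_last (Fin.ne_last_of_lt hpr)
    obtain ⟨p, rfl⟩ := Fin.exists_succ_eq_of_ne_zero (Fin.ne_zero_of_lt hpr)
    rw [← Matrix.mul_assoc (insMat p.succ a)ᴴ,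
      conjTranspose_insMat_succ_mul_insMat_castSucc (Fin.castSucc_lt_succ_iff.1 hpr),
      Matrix.mul_assoc]
    exact key _ _ _ _

/-- No count is needed in this direction: the commutation relations allow equal positions, and the
deletion on the right already guarantees a qudit. -/
theorem ins_del_of_del_ins {u v : List Bool}
    (h : WordIn G (u ++ false :: true :: v)) : WordIn G (u ++ true :: false :: v) := by
  intro A hA
  obtain ⟨k, B, D, hB, hD, rfl⟩ := hA.exists_of_append
  cases hD with
  | @ins _ l _ _ r b hD =>
  cases hD with
  | @del _ _ _ D p a hD =>
  have key : ∀ (p' r' : Fin (l + 2)) (a' b' : Fin q),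
      B * ((insMat p' a')ᴴ * (insMat r' b' * D)) ∈ G := fun p' r' a' b' =>
    h _ (hB.append ((hD.ins r' b').del p' a'))
  rcases le_total p r with hpr | hpr
  · rw [← Matrix.mul_assoc (insMat r b),
      ← conjTranspose_insMat_castSucc_mul_insMat_succ hpr, Matrix.mul_assoc]
    exact key _ _ _ _
  · rw [← Matrix.mul_assoc (insMat r b),
      ← conjTranspose_insMat_succ_mul_insMat_castSucc hpr, Matrix.mul_assoc]
    exact key _ _ _ _

theorem del_ins_iff {u v : List Bool} (hv : v.count false < n + v.count true) :
    WordIn G (u ++ false :: true :: v) ↔ WordIn G (u ++ true :: false :: v) :=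
  ⟨ins_del_of_del_ins, del_ins_of_ins_del hv⟩

theorem replicate_del_ins_iff {u v : List Bool} (k : ℕ)
    (hv : v.count false + k ≤ n + v.count true) :
    WordIn G (u ++ (List.replicate k false ++ true :: v)) ↔
      WordIn G (u ++ true :: (List.replicate k false ++ v)) := by
  induction k generalizing v with
  | zero => rfl
  | succ k ih =>
    rw [List.replicate_succ', List.append_assoc, List.append_assoc, List.singleton_append,
      List.singleton_append, ← List.append_assoc, del_ins_iff (by omega), List.append_assoc]
    exact ih (by simp; omega)

theorem del_replicate_ins_iff {u v : List Bool} (k : ℕ)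
    (hv : v.count false < n + v.count true) :
    WordIn G (u ++ false :: (List.replicate k true ++ v)) ↔
      WordIn G (u ++ (List.replicate k true ++ false :: v)) := by
  induction k generalizing v with
  | zero => rfl
  | succ k ih =>
    rw [List.replicate_succ', List.append_assoc, List.append_assoc, List.singleton_append,
      List.singleton_append, ih (by simp; omega), ← List.append_assoc, del_ins_iff hv,
      List.append_assoc]

end WordIn

/-- The word of the products `Eᴴ * E'`, for `E` and `E'` two errors of a `(t₁, t₂)`-insdel
channel. -/
def insdelWord (t₁ t₂ : ℕ) : List Bool :=
  List.replicate t₂ true ++ (List.replicate t₁ false ++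
    (List.replicate t₁ true ++ List.replicate t₂ false))

/-- The leftmost of the `t₁ + 1` inner insertions travels left across all the deletions before it;
then the rightmost of those deletions travels right across the remaining `t₁` insertions. The bound
`t₂ < n` keeps a qudit available at every exchange. -/
theorem wordIn_insdelWord_succ_iff {q m n : ℕ}
    {G : Submodule ℂ (Matrix (Fin m → Fin q) (Fin n → Fin q) ℂ)} {t₁ t₂ : ℕ} (h : t₂ < n) :
    WordIn G (insdelWord (t₁ + 1) t₂) ↔ WordIn G (insdelWord t₁ (t₂ + 1)) := by
  have e1 : insdelWord (t₁ + 1) t₂ = List.replicate t₂ true ++ (List.replicate (t₁ + 1) false ++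
      true :: (List.replicate t₁ true ++ List.replicate t₂ false)) := by
    simp [insdelWord, List.replicate_succ (n := t₁) (a := true)]
  have e2 : List.replicate t₂ true ++ true :: (List.replicate (t₁ + 1) false ++
      (List.replicate t₁ true ++ List.replicate t₂ false)) =
      (List.replicate (t₂ + 1) true ++ List.replicate t₁ false) ++
        false :: (List.replicate t₁ true ++ List.replicate t₂ false) := by
    simp [List.replicate_succ']
  have e3 : (List.replicate (t₂ + 1) true ++ List.replicate t₁ false) ++
      (List.replicate t₁ true ++ false :: List.replicate t₂ false) = insdelWord t₁ (t₂ + 1) := by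
    simp [insdelWord, List.replicate_succ (n := t₂) (a := false)]
  rw [e1, WordIn.replicate_del_ins_iff _ (by simp [List.count_replicate]; omega), e2,
    WordIn.del_replicate_ins_iff _ (by simpa [List.count_replicate] using h), e3]

theorem wordIn_insdelWord_iff_zero {q m n : ℕ}
    {G : Submodule ℂ (Matrix (Fin m → Fin q) (Fin n → Fin q) ℂ)} {t₁ t₂ : ℕ} (h : t₂ ≤ n) :
    WordIn G (insdelWord t₁ t₂) ↔ WordIn G (insdelWord (t₁ + t₂) 0) := by
  induction t₂ generalizing t₁ with
  | zero => rfl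
  | succ t₂ ih =>
    rw [← wordIn_insdelWord_succ_iff (by omega), ih (by omega)]
    congr! 2
    omega

/-! ### Sorting insertions -/

/-- Insert the basis vectors `a 0` at `p 0`, then `a 1` at `p 1`, and so on. -/
def insSeqMat {q n : ℕ} : (t : ℕ) → ((i : Fin t) → Fin (n + i + 1)) → (Fin t → Fin q) →
    Matrix (Fin (n + t) → Fin q) (Fin n → Fin q) ℂ
  | 0, _, _ => 1
  | t + 1, p, a => insMat (n := n + t) (p (Fin.last t)) (a (Fin.last t)) *
      insSeqMat t (fun i => p i.castSucc) (fun i => a i.castSucc)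

theorem exists_insMat_mul_insSeqMat_eq_insSeqMat_succ {q n : ℕ} (t : ℕ)
    (p : (i : Fin t) → Fin (n + i + 1))
    (a : Fin t → Fin q) (hp : ∀ i j, i < j → (p i : ℕ) < p j) (r : Fin (n + t + 1)) (b : Fin q)
    (hr : ∀ i, (p i : ℕ) < r) :
    ∃ (p' : (i : Fin (t + 1)) → Fin (n + i + 1)) (a' : Fin (t + 1) → Fin q),
      (∀ i j, i < j → (p' i : ℕ) < p' j) ∧ (∀ i, (p' i : ℕ) ≤ r) ∧
      insMat r b * insSeqMat t p a = insSeqMat (t + 1) p' a' := by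
  refine ⟨Fin.snoc (α := fun i : Fin (t + 1) => Fin (n + i + 1)) p r,
    Fin.snoc (α := fun _ => Fin q) a b, ?_, ?_, ?_⟩
  · intro i j hij
    induction j using Fin.lastCases with
    | last =>
      obtain ⟨i, rfl⟩ := Fin.eq_castSucc_of_ne_last hij.ne
      simpa using hr i
    | cast j =>
      obtain ⟨i, rfl⟩ := Fin.eq_castSucc_of_ne_last (hij.trans (Fin.castSucc_lt_last j)).ne
      simpa using hp i j (by simpa using hij)
  · intro i
    induction i using Fin.lastCases with
    | last => simp
    | cast i => simpa using (hr i).le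
  · simp [insSeqMat]

/-- One step of insertion sort. If `r` does not exceed the last position `l`, the commutation rule
moves that insertion to `l + 1`, and `r` is sorted recursively into the shorter sequence. The bound
`k` is carried along so that the recursive result, taken with bound `l`, stays below `l + 1`. -/
theorem exists_insMat_mul_insSeqMat {q n : ℕ} (t : ℕ) (p : (i : Fin t) → Fin (n + i + 1))
    (a : Fin t → Fin q) (hp : ∀ i j, i < j → (p i : ℕ) < p j) (r : Fin (n + t + 1)) (b : Fin q)
    (k : ℕ) (hk : ∀ i, (p i : ℕ) < k) (hr : (r : ℕ) ≤ k) :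
    ∃ (p' : (i : Fin (t + 1)) → Fin (n + i + 1)) (a' : Fin (t + 1) → Fin q),
      (∀ i j, i < j → (p' i : ℕ) < p' j) ∧ (∀ i, (p' i : ℕ) ≤ k) ∧
      insMat r b * insSeqMat t p a = insSeqMat (t + 1) p' a' := by
  induction t generalizing k with
  | zero =>
    obtain ⟨p', a', h1, h2, h3⟩ := exists_insMat_mul_insSeqMat_eq_insSeqMat_succ 0 p a hp r b
      (fun i => i.elim0)
    exact ⟨p', a', h1, fun i => (h2 i).trans hr, h3⟩
  | succ t ih =>
    rcases lt_or_ge (p (Fin.last t) : ℕ) r with hlt | hge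
    · obtain ⟨p', a', h1, h2, h3⟩ :=
        exists_insMat_mul_insSeqMat_eq_insSeqMat_succ (t + 1) p a hp r b (fun i => by
          rcases (Fin.le_last i).lt_or_eq with h | rfl
          · exact (hp _ _ h).trans hlt
          · exact hlt)
      exact ⟨p', a', h1, fun i => (h2 i).trans hr, h3⟩
    · set l : Fin (n + t + 1) := p (Fin.last t) with hl
      obtain ⟨r, rfl⟩ : ∃ r' : Fin (n + t + 1), r'.castSucc = r :=
        ⟨⟨r, by have := l.isLt; simp only [hl] at this; simp at hge; omega⟩, rfl⟩
      obtain ⟨p', a', h1, h2, h3⟩ := ih (fun i => p i.castSucc) (fun i => a i.castSucc)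
        (fun i j hij => hp _ _ (by simpa using hij)) r l
        (fun i => hp _ _ (Fin.castSucc_lt_last i)) (by simpa using hge)
      obtain ⟨p'', a'', h1', h2', h3'⟩ := exists_insMat_mul_insSeqMat_eq_insSeqMat_succ (t + 1)
        p' a' h1 l.succ (a (Fin.last t)) (fun i => by
          rw [Fin.val_succ]; exact Nat.lt_succ_of_le (h2 i))
      refine ⟨p'', a'', h1', fun i => (h2' i).trans (by
        rw [Fin.val_succ]; exact hk (Fin.last t)), ?_⟩
      rw [← h3', ← h3]
      have hrl : r ≤ l := by
        rw [Fin.le_def]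
        simpa using hge
      rw [← Matrix.mul_assoc, insMat_succ_mul_insMat hrl, Matrix.mul_assoc]
      rfl

theorem PosSet.exists_pos_eq {n t : ℕ} (p : (i : Fin t) → Fin (n + i + 1))
    (hp : ∀ i j, i < j → (p i : ℕ) < p j) : ∃ P : PosSet n t, P.pos = p := by
  let f : Fin t → Fin (n + t) := fun i => ⟨p i, by have := (p i).isLt; omega⟩
  have hf : StrictMono f := fun i j hij => Fin.lt_def.2 (hp i j hij)
  refine ⟨⟨Finset.univ.image f, ?_⟩, ?_⟩
  · rw [Finset.card_image_of_injective _ hf.injective, Finset.card_univ, Fintype.card_fin]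
  · funext i
    ext
    have := Finset.orderEmbOfFin_unique (f := f) (s := Finset.univ.image f) (k := t)
      (by rw [Finset.card_image_of_injective _ hf.injective, Finset.card_univ, Fintype.card_fin])
      (fun x => Finset.mem_image_of_mem f (Finset.mem_univ x)) hf
    exact (congrArg Fin.val (congrFun this i)).symm

/-- Needed because the channels insert and erase only at increasing positions, whereas the exchange
argument produces arbitrary ones. -/
theorem IsMonomial.exists_eq_insSeqMat {q n t : ℕ}
    {A : Matrix (Fin (n + t) → Fin q) (Fin n → Fin q) ℂ}
    (h : IsMonomial (List.replicate t true) (n + t) n A) :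
    ∃ (P : PosSet n t) (a : Fin t → Fin q), A = insSeqMat t P.pos a := by
  suffices H : ∃ (p : (i : Fin t) → Fin (n + i + 1)) (a : Fin t → Fin q),
      (∀ i j, i < j → (p i : ℕ) < p j) ∧ A = insSeqMat t p a by
    obtain ⟨p, a, hp, rfl⟩ := H
    obtain ⟨P, rfl⟩ := PosSet.exists_pos_eq p hp
    exact ⟨P, a, rfl⟩
  induction t with
  | zero =>
    cases h
    exact ⟨fun i => i.elim0, fun i => i.elim0, fun i => i.elim0, rfl⟩
  | succ t ih =>
    rw [List.replicate_succ] at h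
    cases h with
    | ins r b hA =>
      obtain ⟨p, a, hp, rfl⟩ := ih hA
      obtain ⟨p', a', hp', -, h⟩ := exists_insMat_mul_insSeqMat t p a hp r b (n + t)
        (fun i => by have := (p i).isLt; omega) (Nat.le_of_lt_succ r.isLt)
      exact ⟨p', a', hp', h⟩

/-! ### Kraus decompositions -/

section Kraus

variable {ι κ α : Type*} [Fintype ι] [Fintype α]

/-- The completely positive map with Kraus operators `K a`. -/
def krausMap (K : α → Matrix κ ι ℂ) : Matrix ι ι ℂ →ₗ[ℂ] Matrix κ κ ℂ where
  toFun X := ∑ a, K a * X * (K a)ᴴ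
  map_add' X Y := by simp [Matrix.mul_add, Matrix.add_mul, Finset.sum_add_distrib]
  map_smul' c X := by simp [Finset.smul_sum]

theorem krausMap_apply (K : α → Matrix κ ι ℂ) (X : Matrix ι ι ℂ) :
    krausMap K X = ∑ a, K a * X * (K a)ᴴ := rfl

variable [Fintype κ]

theorem posSemidef_ampliation_krausMap (K : α → Matrix κ ι ℂ) (k : ℕ)
    (X : Matrix (ι × Fin k) (ι × Fin k) ℂ) (hX : X.PosSemidef) :
    (ampliation k (krausMap K) X).PosSemidef := by
  -- `B a` is `K a ⊗ 1`, a Kraus operator of the ampliation.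
  let B : α → Matrix (κ × Fin k) (ι × Fin k) ℂ := fun a =>
    Matrix.of fun u v => if u.2 = v.2 then K a u.1 v.1 else 0
  have : ampliation k (krausMap K) X = ∑ a, B a * X * (B a)ᴴ := by
    ext u v
    simp only [ampliation, krausMap_apply, of_apply, Matrix.sum_apply, mul_apply,
      conjTranspose_apply, Fintype.sum_prod_type, B]
    refine Finset.sum_congr rfl fun a _ => Finset.sum_congr rfl fun i _ => ?_
    simp only [apply_ite star, star_zero, ite_mul, zero_mul, mul_ite, mul_zero,
      Finset.sum_ite_eq, Finset.mem_univ, if_true]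
  rw [this]
  exact posSemidef_sum _ fun a _ => hX.mul_mul_conjTranspose_same _

theorem isQuantumChannel_krausMap [DecidableEq ι] (K : α → Matrix κ ι ℂ)
    (hK : ∑ a, (K a)ᴴ * K a = 1) : IsQuantumChannel (krausMap K) := by
  refine ⟨posSemidef_ampliation_krausMap K, fun X => ?_⟩
  calc (krausMap K X).trace = ∑ a, ((K a)ᴴ * K a * X).trace := by
        rw [krausMap_apply, trace_sum]
        refine Finset.sum_congr rfl fun a _ => ?_
        rw [Matrix.trace_mul_comm, Matrix.mul_assoc]
    _ = X.trace := by rw [← trace_sum, ← Matrix.sum_mul, hK, Matrix.one_mul]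

/-- Choi's theorem. -/
theorem exists_krausMap_eq (Φ : Matrix ι ι ℂ →ₗ[ℂ] Matrix κ κ ℂ)
    (hΦ : ∀ (k : ℕ) (X : Matrix (ι × Fin k) (ι × Fin k) ℂ),
      X.PosSemidef → (ampliation k Φ X).PosSemidef) :
    ∃ (m : ℕ) (K : Fin m → Matrix κ ι ℂ), Φ = krausMap K := by
  classical
  let e := Fintype.equivFin ι
  -- The unnormalised maximally entangled vector. The ampliation sends its projector to the Choi
  -- matrix; the rank-one summands of that matrix, reshaped, are the Kraus operators.
  let v : ι × Fin (Fintype.card ι) → ℂ := fun i => if i.1 = e.symm i.2 then 1 else 0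
  obtain ⟨m, w, hw⟩ := posSemidef_iff_eq_sum_vecMulVec.1
    (hΦ _ _ (posSemidef_vecMulVec_self_star v))
  have hsingle : ∀ (i j : ι) (x y : κ),
      Φ (single i j 1) x y = ∑ a, w a (x, e i) * star (w a (y, e j)) := by
    intro i j x y
    have h := congrFun (congrFun hw (x, e i)) (y, e j)
    rw [Matrix.sum_apply] at h
    simp only [vecMulVec_apply, Pi.star_apply] at h
    rw [← h, ampliation, of_apply]
    refine congrFun (congrFun (congrArg Φ ?_) x) y
    ext i' j'
    simp only [v, of_apply, vecMulVec_apply, Pi.star_apply, Equiv.symm_apply_apply, single_apply]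
    by_cases h1 : i' = i <;> by_cases h2 : j' = j <;> simp [h1, h2, eq_comm (a := i), eq_comm (a := j)]
  refine ⟨m, fun a => Matrix.of fun x i => w a (x, e i), ?_⟩
  refine LinearMap.ext fun X => ?_
  conv_lhs => rw [matrix_eq_sum_single X]
  simp only [map_sum]
  ext x y
  simp only [krausMap_apply, Matrix.sum_apply, mul_apply, of_apply, conjTranspose_apply,
    Finset.sum_mul]
  have : ∀ i j, Φ (single i j (X i j)) x y =
      ∑ a, w a (x, e i) * X i j * star (w a (y, e j)) := by
    intro i j
    have h1 : single i j (X i j) = X i j • single i j (1 : ℂ) := by simp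
    rw [h1, map_smul, Matrix.smul_apply, hsingle, smul_eq_mul, Finset.mul_sum]
    exact Finset.sum_congr rfl fun a _ => by ring
  simp only [this]
  calc ∑ i, ∑ j, ∑ a, w a (x, e i) * X i j * star (w a (y, e j))
      = ∑ i, ∑ a, ∑ j, w a (x, e i) * X i j * star (w a (y, e j)) :=
        Finset.sum_congr rfl fun i _ => Finset.sum_comm
    _ = ∑ a, ∑ i, ∑ j, w a (x, e i) * X i j * star (w a (y, e j)) := Finset.sum_comm
    _ = _ := Finset.sum_congr rfl fun _ _ => Finset.sum_comm

theorem sum_conjTranspose_mul_self_of_trace [DecidableEq ι] (K : α → Matrix κ ι ℂ)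
    (hK : ∀ X, (krausMap K X).trace = X.trace) : ∑ a, (K a)ᴴ * K a = 1 := by
  rw [ext_iff_trace_mul_right]
  intro X
  rw [Matrix.one_mul, ← hK X, krausMap_apply, trace_sum, Matrix.sum_mul, trace_sum]
  refine Finset.sum_congr rfl fun a _ => ?_
  rw [Matrix.trace_mul_comm (K a * X), Matrix.mul_assoc]

theorem posSemidef_krausMap (K : α → Matrix κ ι ℂ) {X : Matrix ι ι ℂ} (hX : X.PosSemidef) :
    (krausMap K X).PosSemidef :=
  posSemidef_sum _ fun _ _ => hX.mul_mul_conjTranspose_same _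

theorem posSemidef_krausMap_sub (K : α → Matrix κ ι ℂ) {X : Matrix ι ι ℂ} (hX : X.PosSemidef)
    (a : α) : (krausMap K X - K a * X * (K a)ᴴ).PosSemidef := by
  classical
  rw [krausMap_apply, ← Finset.add_sum_erase _ _ (Finset.mem_univ a), add_sub_cancel_left]
  exact posSemidef_sum _ fun _ _ => hX.mul_mul_conjTranspose_same _

end Kraus

/-! ### The Knill-Laflamme conditions -/

section KnillLaflamme

variable {ι κ : Type*} [Fintype ι] [Fintype κ]

/-- The operators whose compression to the code `C` is a multiple of the identity. -/
def scalarOn (C : Submodule ℂ (ι → ℂ)) : Submodule ℂ (Matrix ι ι ℂ) where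
  carrier := {A | ∃ c : ℂ, ∀ ψ ∈ C, ∀ φ ∈ C, star ψ ⬝ᵥ (A *ᵥ φ) = c * (star ψ ⬝ᵥ φ)}
  zero_mem' := ⟨0, by simp⟩
  add_mem' := by
    rintro A B ⟨c, hc⟩ ⟨d, hd⟩
    refine ⟨c + d, fun ψ hψ φ hφ => ?_⟩
    rw [add_mulVec, dotProduct_add, hc ψ hψ φ hφ, hd ψ hψ φ hφ, add_mul]
  smul_mem' := by
    rintro a A ⟨c, hc⟩
    refine ⟨a * c, fun ψ hψ φ hφ => ?_⟩
    rw [smul_mulVec, dotProduct_smul, hc ψ hψ φ hφ, smul_eq_mul, mul_assoc]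

/-- `E` is, up to a positive factor, one of the Kraus operators of `Φ`. -/
def Dominates (Φ : Matrix ι ι ℂ → Matrix κ κ ℂ) (E : Matrix κ ι ℂ) : Prop :=
  ∃ c : ℝ, 0 < c ∧ ∀ M : Matrix ι ι ℂ, M.PosSemidef →
    (Φ M - (c : ℂ) • (E * M * Eᴴ)).PosSemidef

theorem star_mulVec_dotProduct_mulVec (A B : Matrix κ ι ℂ) (ψ φ : ι → ℂ) :
    star (A *ᵥ ψ) ⬝ᵥ (B *ᵥ φ) = star ψ ⬝ᵥ ((Aᴴ * B) *ᵥ φ) := by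
  rw [star_mulVec, ← dotProduct_mulVec, mulVec_mulVec]

theorem star_dotProduct_eq_zero_comm {ψ χ : ι → ℂ} : star χ ⬝ᵥ ψ = 0 ↔ star ψ ⬝ᵥ χ = 0 := by
  rw [star_dotProduct, star_eq_zero]

/-- A recovered pure state `ρ` dominates a positive multiple of its image under `K a * E`. Since `ρ`
vanishes on vectors orthogonal to `ψ`, so does that image. -/
theorem star_dotProduct_eq_zero_of_corrects {C : Submodule ℂ (ι → ℂ)}
    {Φ : Matrix ι ι ℂ → Matrix κ κ ℂ} {m : ℕ} {K : Fin m → Matrix ι κ ℂ}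
    (hR : ∀ ρ : Matrix ι ι ℂ, IsDensity ρ → SupportedOn C ρ → krausMap K (Φ ρ) = ρ)
    {E : Matrix κ ι ℂ} (hE : Dominates Φ E) (a : Fin m) {ψ χ : ι → ℂ} (hψ : ψ ∈ C)
    (hχ : star χ ⬝ᵥ ψ = 0) : star χ ⬝ᵥ ((K a * E) *ᵥ ψ) = 0 := by
  obtain ⟨c, hc, hE⟩ := hE
  by_cases hψ0 : ψ = 0
  · simp [hψ0]
  have hpos : 0 < star ψ ⬝ᵥ ψ := dotProduct_star_self_pos_iff.2 hψ0
  set s : ℂ := (star ψ ⬝ᵥ ψ)⁻¹ with hs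
  have hs0 : 0 < s := inv_pos.2 hpos
  set ρ : Matrix ι ι ℂ := s • vecMulVec ψ (star ψ) with hρ
  have hρpos : ρ.PosSemidef := (posSemidef_vecMulVec_self_star ψ).smul hs0.le
  have hρd : IsDensity ρ := by
    refine ⟨hρpos, ?_⟩
    rw [hρ, trace_smul, trace_vecMulVec, dotProduct_comm, smul_eq_mul]
    exact inv_mul_cancel₀ hpos.ne'
  have hρs : SupportedOn C ρ := by
    intro v
    rw [hρ, smul_mulVec, vecMulVec_mulVec]
    exact C.smul_mem _ (by simpa using C.smul_mem _ hψ)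
  have h1 : (ρ - (c : ℂ) • (K a * (E * ρ * Eᴴ) * (K a)ᴴ)).PosSemidef := by
    have h2 := posSemidef_krausMap K (hE ρ hρpos)
    rw [map_sub, hR ρ hρd hρs, map_smul] at h2
    have h3 := (posSemidef_krausMap_sub K (hρpos.mul_mul_conjTranspose_same E) a).smul
      (α := ℂ) (a := (c : ℂ)) (by exact_mod_cast hc.le)
    have h4 := h2.add h3
    rwa [smul_sub, sub_add_sub_cancel] at h4
  -- Tested on `χ`, the positive term vanishes, leaving `0 ≤ -(c * s * |z|²)` with `c` and `s`
  -- positive.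
  have h5 := h1.dotProduct_mulVec_nonneg χ
  have h6 : star ψ ⬝ᵥ χ = 0 := star_dotProduct_eq_zero_comm.1 hχ
  set z := star χ ⬝ᵥ ((K a * E) *ᵥ ψ) with hz
  have h7 : star χ ⬝ᵥ ((K a * (E * ρ * Eᴴ) * (K a)ᴴ) *ᵥ χ) = s * (z * star z) := by
    have e : K a * (E * ρ * Eᴴ) * (K a)ᴴ =
        s • vecMulVec ((K a * E) *ᵥ ψ) (star ((K a * E) *ᵥ ψ)) := by
      have : vecMulVec ((K a * E) *ᵥ ψ) (star ((K a * E) *ᵥ ψ)) =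
          (K a * E) * vecMulVec ψ (star ψ) * (K a * E)ᴴ := by
        rw [mul_vecMulVec, vecMulVec_mul, star_mulVec]
      rw [this, hρ, conjTranspose_mul]
      simp [Matrix.mul_assoc]
    rw [e, smul_mulVec, dotProduct_smul, vecMulVec_mulVec, op_smul_eq_smul, dotProduct_smul,
      smul_eq_mul, smul_eq_mul, ← hz, star_dotProduct, ← hz, mul_comm z]
  have h8 : star χ ⬝ᵥ (ρ *ᵥ χ) = 0 := by
    rw [hρ, smul_mulVec, vecMulVec_mulVec]
    simp [h6]
  rw [sub_mulVec, dotProduct_sub, h8, smul_mulVec, dotProduct_smul, h7, zero_sub, smul_eq_mul,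
    ← mul_assoc] at h5
  have h9 : 0 < (c : ℂ) * s := mul_pos (by exact_mod_cast hc) hs0
  have h10 : 0 ≤ z * star z := mul_star_self_nonneg z
  have h11 : z * star z = 0 := by
    by_contra hne
    have := mul_pos h9 (lt_of_le_of_ne h10 (Ne.symm hne))
    exact absurd h5 (not_le_of_gt (neg_lt_zero.2 this))
  simpa using h11

/-- `A *ᵥ ψ` has no component orthogonal to `ψ`, so every vector of `C` is an eigenvector, and a
linear map with this property is a scalar. -/
theorem exists_mulVec_eq_smul {C : Submodule ℂ (ι → ℂ)} {A : Matrix ι ι ℂ}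
    (hA : ∀ ψ ∈ C, ∀ χ : ι → ℂ, star χ ⬝ᵥ ψ = 0 → star χ ⬝ᵥ (A *ᵥ ψ) = 0) :
    ∃ c : ℂ, ∀ ψ ∈ C, A *ᵥ ψ = c • ψ := by
  have h1 : ∀ ψ ∈ C, ∃ c : ℂ, A *ᵥ ψ = c • ψ := by
    intro ψ hψ
    by_cases hψ0 : ψ = 0
    · exact ⟨0, by simp [hψ0]⟩
    have hne : star ψ ⬝ᵥ ψ ≠ 0 := (dotProduct_star_self_pos_iff.2 hψ0).ne'
    refine ⟨(star ψ ⬝ᵥ (A *ᵥ ψ)) / (star ψ ⬝ᵥ ψ), ?_⟩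
    set c := (star ψ ⬝ᵥ (A *ᵥ ψ)) / (star ψ ⬝ᵥ ψ) with hc
    set χ := A *ᵥ ψ - c • ψ with hχ
    have h2 : star ψ ⬝ᵥ χ = 0 := by
      rw [hχ, dotProduct_sub, dotProduct_smul, smul_eq_mul, hc, div_mul_cancel₀ _ hne, sub_self]
    have h3 : star χ ⬝ᵥ ψ = 0 := star_dotProduct_eq_zero_comm.1 h2
    have h4 : star χ ⬝ᵥ χ = 0 := by
      conv_lhs => rw [hχ]
      rw [dotProduct_sub, dotProduct_smul, ← hχ, h3, hA ψ hψ χ h3]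
      simp
    exact sub_eq_zero.1 (dotProduct_star_self_eq_zero.1 h4)
  have hmaps : ∀ ψ ∈ C, A.mulVecLin ψ ∈ C := by
    intro ψ hψ
    obtain ⟨c, hc⟩ := h1 ψ hψ
    rw [mulVecLin_apply, hc]
    exact C.smul_mem _ hψ
  obtain ⟨c, hc⟩ := LinearMap.exists_eq_smul_id_of_forall_notLinearIndependent
    (f := A.mulVecLin.restrict hmaps) (by
      intro v hv
      obtain ⟨c, hc⟩ := h1 v v.2
      have := LinearIndependent.pair_iff.1 hv c (-1) (by
        ext1
        simp [hc])
      simpa using this.2)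
  refine ⟨c, fun ψ hψ => ?_⟩
  have := congrArg Subtype.val (LinearMap.congr_fun hc ⟨ψ, hψ⟩)
  simpa using this

/-- Necessity of Knill-Laflamme: each `K a * E` and `K a * E'` is a scalar on `C`, and `∑ (K a)ᴴ * K
a = 1` writes `Eᴴ * E'` as the sum of the products `(K a * E)ᴴ * (K a * E')`. -/
theorem conjTranspose_mul_mem_scalarOn {C : Submodule ℂ (ι → ℂ)}
    {Φ : Matrix ι ι ℂ → Matrix κ κ ℂ} (hΦ : Corrects C Φ) {E E' : Matrix κ ι ℂ}
    (hE : Dominates Φ E) (hE' : Dominates Φ E') : Eᴴ * E' ∈ scalarOn C := by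
  classical
  obtain ⟨R, ⟨hcp, htp⟩, hR⟩ := hΦ
  obtain ⟨m, K, rfl⟩ := exists_krausMap_eq R hcp
  have hK := sum_conjTranspose_mul_self_of_trace K htp
  have h : ∀ {F : Matrix κ ι ℂ}, Dominates Φ F →
      ∃ c : Fin m → ℂ, ∀ a, ∀ ψ ∈ C, (K a * F) *ᵥ ψ = c a • ψ := by
    intro F hF
    choose c hc using fun a => exists_mulVec_eq_smul (C := C) (A := K a * F)
      fun ψ hψ χ hχ => star_dotProduct_eq_zero_of_corrects hR hF a hψ hχ
    exact ⟨c, hc⟩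
  obtain ⟨c, hc⟩ := h hE
  obtain ⟨c', hc'⟩ := h hE'
  refine ⟨∑ a, star (c a) * c' a, fun ψ hψ φ hφ => ?_⟩
  have e : Eᴴ * E' = ∑ a, (K a * E)ᴴ * (K a * E') := by
    calc Eᴴ * E' = Eᴴ * (∑ a, (K a)ᴴ * K a) * E' := by rw [hK, Matrix.mul_one]
      _ = _ := by simp only [Matrix.mul_sum, Matrix.sum_mul, conjTranspose_mul, Matrix.mul_assoc]
  rw [e, sum_mulVec, dotProduct_sum, Finset.sum_mul]
  refine Finset.sum_congr rfl fun a _ => ?_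
  rw [← star_mulVec_dotProduct_mulVec, hc a ψ hψ, hc' a φ hφ, star_smul, smul_dotProduct,
    dotProduct_smul, smul_eq_mul, smul_eq_mul, mul_assoc]

/-- An orthonormal basis of a subspace, as the columns of a matrix. -/
theorem exists_isometry (C : Submodule ℂ (ι → ℂ)) :
    ∃ (d : ℕ) (V : Matrix ι (Fin d) ℂ), Vᴴ * V = 1 ∧ (∀ j, V.col j ∈ C) ∧
      ∀ ψ ∈ C, (V * Vᴴ) *ᵥ ψ = ψ := by
  let C' : Submodule ℂ (EuclideanSpace ℂ ι) := C.comap (WithLp.linearEquiv 2 ℂ (ι → ℂ)).toLinearMap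
  let b := stdOrthonormalBasis ℂ C'
  refine ⟨_, Matrix.of fun i j => (b j : EuclideanSpace ℂ ι) i, ?_, fun j => (b j).2, ?_⟩
  · ext j k
    have := orthonormal_iff_ite.1 b.orthonormal j k
    rw [Submodule.coe_inner, EuclideanSpace.inner_eq_star_dotProduct] at this
    rw [one_apply, ← this, mul_apply, dotProduct]
    exact Finset.sum_congr rfl fun i _ => mul_comm _ _
  · intro ψ hψ
    have := b.sum_repr ⟨WithLp.toLp 2 ψ, hψ⟩
    have h2 := congrArg (fun v : C' => (v : EuclideanSpace ℂ ι).ofLp) this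
    rw [← mulVec_mulVec]
    conv_rhs => rw [← show _ = ψ from h2]
    ext i
    simp only [b.repr_apply_apply, Submodule.coe_inner, EuclideanSpace.inner_eq_star_dotProduct]
    simp only [mulVec, dotProduct, of_apply, conjTranspose_apply]
    simp [mul_comm]

/-- For a unit vector `ψ₀` of `C`, the scalar of `Eᴴ * E'` is the inner product of `E *ᵥ ψ₀` and `E'
*ᵥ ψ₀`. So an error is determined on `C` by its value at `ψ₀`, and lifting an orthonormal basis of
these values gives the `F k`. -/
theorem exists_orthogonal_errors (C : Submodule ℂ (ι → ℂ)) (𝓔 : Submodule ℂ (Matrix κ ι ℂ))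
    (h : ∀ E ∈ 𝓔, ∀ E' ∈ 𝓔, Eᴴ * E' ∈ scalarOn C) :
    ∃ (r : ℕ) (F : Fin r → Matrix κ ι ℂ),
      (∀ k l, ∀ ψ ∈ C, ∀ φ ∈ C, star ψ ⬝ᵥ (((F k)ᴴ * F l) *ᵥ φ) =
        if k = l then star ψ ⬝ᵥ φ else 0) ∧
      ∀ E ∈ 𝓔, ∃ c : Fin r → ℂ, ∀ ψ ∈ C, E *ᵥ ψ = ∑ k, c k • (F k *ᵥ ψ) := by
  obtain ⟨d, V, hV, hVC, hVψ⟩ := exists_isometry C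
  rcases Nat.eq_zero_or_pos d with rfl | hd
  · refine ⟨0, fun k => k.elim0, fun k => k.elim0, fun E _ => ⟨fun k => k.elim0, ?_⟩⟩
    intro ψ hψ
    rw [← hVψ ψ hψ, Subsingleton.elim V 0]
    simp
  set ψ₀ := V.col ⟨0, hd⟩ with hψ₀
  have hψ₀C : ψ₀ ∈ C := hVC _
  have hψ₀1 : star ψ₀ ⬝ᵥ ψ₀ = 1 := by
    have := congrFun (congrFun hV ⟨0, hd⟩) ⟨0, hd⟩
    rwa [one_apply_eq] at this
  have key : ∀ E ∈ 𝓔, ∀ E' ∈ 𝓔, ∀ ψ ∈ C, ∀ φ ∈ C, star ψ ⬝ᵥ ((Eᴴ * E') *ᵥ φ) =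
      (star (E *ᵥ ψ₀) ⬝ᵥ (E' *ᵥ ψ₀)) * (star ψ ⬝ᵥ φ) := by
    intro E hE E' hE' ψ hψ φ hφ
    obtain ⟨c, hc⟩ := h E hE E' hE'
    rw [star_mulVec_dotProduct_mulVec, hc ψ₀ hψ₀C ψ₀ hψ₀C, hψ₀1, mul_one, hc ψ hψ φ hφ]
  obtain ⟨r, U, hU, hUD, hUψ⟩ := exists_isometry (𝓔.map ((mulVecBilin ℂ ℂ).flip ψ₀))
  choose F hF hFU using fun k => Submodule.mem_map.1 (hUD k)
  replace hFU : ∀ k, F k *ᵥ ψ₀ = U.col k := hFU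
  refine ⟨r, F, ?_, ?_⟩
  · intro k l ψ hψ φ hφ
    rw [key _ (hF k) _ (hF l) ψ hψ φ hφ, hFU, hFU]
    have : star (U.col k) ⬝ᵥ U.col l = (1 : Matrix (Fin r) (Fin r) ℂ) k l :=
      congrFun (congrFun hU k) l
    rw [this, one_apply]
    split_ifs <;> simp
  · intro E hE
    set c := Uᴴ *ᵥ (E *ᵥ ψ₀) with hc
    refine ⟨c, fun ψ hψ => ?_⟩
    set G := E - ∑ k, c k • F k with hG
    have hGE : G ∈ 𝓔 :=
      𝓔.sub_mem hE (Submodule.sum_mem _ fun k _ => 𝓔.smul_mem _ (hF k))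
    have hGψ : ∀ φ, G *ᵥ φ = E *ᵥ φ - ∑ k, c k • (F k *ᵥ φ) := fun φ => by
      rw [hG, sub_mulVec, sum_mulVec]
      simp only [smul_mulVec]
    have hG0 : G *ᵥ ψ₀ = 0 := by
      have h1 : (U * Uᴴ) *ᵥ (E *ᵥ ψ₀) = E *ᵥ ψ₀ :=
        hUψ _ (Submodule.mem_map.2 ⟨E, hE, rfl⟩)
      rw [hGψ, sub_eq_zero]
      conv_lhs => rw [← h1, ← mulVec_mulVec, ← hc]
      ext i
      simp [mulVec, dotProduct, hFU, Finset.sum_apply, mul_comm]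
    -- As `G` kills `ψ₀`, the scalar of `Gᴴ * G` is `0`, so `G *ᵥ ψ` has norm zero.
    have h2 := key G hGE G hGE ψ hψ ψ hψ
    rw [hG0, ← star_mulVec_dotProduct_mulVec] at h2
    rw [← sub_eq_zero, ← hGψ]
    exact dotProduct_star_self_eq_zero.1 (by simpa using h2)

theorem mul_mul_conjTranspose_eq {C : Submodule ℂ (ι → ℂ)} {d : ℕ} {V : Matrix ι (Fin d) ℂ}
    (hV : ∀ ψ ∈ C, (V * Vᴴ) *ᵥ ψ = ψ) {ρ : Matrix ι ι ℂ} (hρ : ρ.IsHermitian)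
    (hs : SupportedOn C ρ) : V * (Vᴴ * ρ * V) * Vᴴ = ρ := by
  have h1 : V * Vᴴ * ρ = ρ := by
    refine Matrix.ext_iff_mulVec.2 fun v => ?_
    rw [← mulVec_mulVec, hV _ (hs _)]
  have h2 : ρ * (V * Vᴴ) = ρ := by
    have := congrArg conjTranspose h1
    simpa [hρ.eq, Matrix.mul_assoc] using this
  calc V * (Vᴴ * ρ * V) * Vᴴ = (V * Vᴴ * ρ) * (V * Vᴴ) := by simp only [Matrix.mul_assoc]
    _ = ρ := by rw [h1, h2]

/-- The Knill-Laflamme conditions for a space of errors imply that one channel recovers the code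
from all of them. -/
theorem exists_recovery [Nonempty ι] (C : Submodule ℂ (ι → ℂ)) (𝓔 : Submodule ℂ (Matrix κ ι ℂ))
    (h : ∀ E ∈ 𝓔, ∀ E' ∈ 𝓔, Eᴴ * E' ∈ scalarOn C) :
    ∃ R : Matrix κ κ ℂ →ₗ[ℂ] Matrix ι ι ℂ, IsQuantumChannel R ∧
      ∀ E ∈ 𝓔, ∀ E' ∈ 𝓔, ∀ ρ : Matrix ι ι ℂ, ρ.IsHermitian → SupportedOn C ρ →
        ∃ c : ℂ, R (E * ρ * E'ᴴ) = c • ρ := by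
  classical
  obtain ⟨d, V, hV, hVC, hVψ⟩ := exists_isometry C
  obtain ⟨r, F, hF, hF𝓔⟩ := exists_orthogonal_errors C 𝓔 h
  obtain ⟨x₀⟩ := ‹Nonempty ι›
  set G : Fin r → Matrix κ (Fin d) ℂ := fun k => F k * V with hG
  have hGG : ∀ k l, (G k)ᴴ * G l = if k = l then 1 else 0 := by
    intro k l
    ext i j
    have h1 : ((G k)ᴴ * G l) i j = star (V.col i) ⬝ᵥ (((F k)ᴴ * F l) *ᵥ V.col j) := by
      rw [← star_mulVec_dotProduct_mulVec]
      rfl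
    have h2 : star (V.col i) ⬝ᵥ V.col j = (1 : Matrix (Fin d) (Fin d) ℂ) i j :=
      congrFun (congrFun hV i) j
    rw [h1, hF k l _ (hVC i) _ (hVC j), h2]
    split_ifs <;> rfl
  -- The `G k` are isometries with orthogonal ranges; `Q` projects onto the complement of all of
  -- them.
  set Q : Matrix κ κ ℂ := 1 - ∑ k, G k * (G k)ᴴ with hQ
  have hQG : ∀ k, Q * G k = 0 := by
    intro k
    rw [hQ, Matrix.sub_mul, Matrix.sum_mul, Matrix.one_mul, sub_eq_zero]
    rw [Finset.sum_eq_single k]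
    · rw [Matrix.mul_assoc, hGG, if_pos rfl, Matrix.mul_one]
    · intro l _ hl
      rw [Matrix.mul_assoc, hGG, if_neg hl, Matrix.mul_zero]
    · simp
  have hQH : Qᴴ = Q := by
    rw [hQ, conjTranspose_sub, conjTranspose_one, conjTranspose_sum]
    simp
  have hQQ : Q * Q = Q := by
    calc Q * Q = Q * (1 - ∑ k, G k * (G k)ᴴ) := by rw [← hQ]
      _ = Q := by
        rw [Matrix.mul_sub, Matrix.mul_one, Matrix.mul_sum]
        simp [← Matrix.mul_assoc, hQG]
  -- The first operators undo the `G k`; the others send the complement to the basis state `x₀`,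
  -- only to make the map trace-preserving.
  let K : Fin r ⊕ κ → Matrix ι κ ℂ :=
    Sum.elim (fun k => V * (G k)ᴴ) fun y => single x₀ y (1 : ℂ) * Q
  have hK : ∑ a, (K a)ᴴ * K a = 1 := by
    rw [Fintype.sum_sum_type]
    have h1 : ∀ k, (K (Sum.inl k))ᴴ * K (Sum.inl k) = G k * (G k)ᴴ := by
      intro k
      simp only [K, Sum.elim_inl, conjTranspose_mul, conjTranspose_conjTranspose]
      rw [Matrix.mul_assoc, ← Matrix.mul_assoc Vᴴ, hV, Matrix.one_mul]
    have h2 : ∀ y, (K (Sum.inr y))ᴴ * K (Sum.inr y) = Q * single y y 1 * Q := by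
      intro y
      simp only [K, Sum.elim_inr, conjTranspose_mul, hQH, conjTranspose_single]
      rw [Matrix.mul_assoc, ← Matrix.mul_assoc (single y x₀ _)]
      simp [Matrix.mul_assoc]
    have h3 : ∑ y : κ, single y y (1 : ℂ) = 1 := by
      ext i j
      simp [Matrix.sum_apply, single_apply, one_apply, ite_and]
    simp only [h1, h2]
    rw [← Matrix.sum_mul, ← Matrix.mul_sum, h3, Matrix.mul_one, hQQ, hQ, add_sub_cancel]
  refine ⟨krausMap K, isQuantumChannel_krausMap K hK, ?_⟩
  intro E hE E' hE' ρ hρ hs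
  have hEV : ∀ E ∈ 𝓔, ∃ c : Fin r → ℂ, E * V = ∑ k, c k • G k := by
    intro E hE
    obtain ⟨c, hc⟩ := hF𝓔 E hE
    refine ⟨c, ?_⟩
    ext i j
    have := congrFun (hc _ (hVC j)) i
    simp only [Matrix.sum_apply, Matrix.smul_apply]
    rw [Finset.sum_apply] at this
    exact this
  obtain ⟨c, hc⟩ := hEV E hE
  obtain ⟨c', hc'⟩ := hEV E' hE'
  set σ := Vᴴ * ρ * V with hσ
  have hρσ : V * σ * Vᴴ = ρ := mul_mul_conjTranspose_eq hVψ hρ hs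
  have e1 : E * ρ * E'ᴴ = (∑ k, c k • G k) * σ * (∑ k, c' k • G k)ᴴ := by
    rw [← hc, ← hc', conjTranspose_mul]
    conv_lhs => rw [← hρσ]
    simp only [Matrix.mul_assoc]
  have h1 : ∀ k, (G k)ᴴ * (∑ l, c l • G l) = c k • 1 := by
    intro k
    simp [Matrix.mul_sum, hGG]
  have h1' : ∀ k, (∑ l, c' l • G l)ᴴ * G k = star (c' k) • 1 := by
    intro k
    simp [conjTranspose_sum, Matrix.sum_mul, hGG]
  have h2 : Q * (∑ l, c l • G l) = 0 := by
    simp [Matrix.mul_sum, hQG]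
  refine ⟨∑ k, c k * star (c' k), ?_⟩
  rw [e1, krausMap_apply, Fintype.sum_sum_type]
  have h3 : ∀ k, K (Sum.inl k) * ((∑ k, c k • G k) * σ * (∑ k, c' k • G k)ᴴ) *
      (K (Sum.inl k))ᴴ = (c k * star (c' k)) • ρ := by
    intro k
    simp only [K, Sum.elim_inl, conjTranspose_mul, conjTranspose_conjTranspose]
    calc V * (G k)ᴴ * ((∑ k, c k • G k) * σ * (∑ k, c' k • G k)ᴴ) * (G k * Vᴴ)
        = V * ((G k)ᴴ * (∑ k, c k • G k)) * σ * ((∑ k, c' k • G k)ᴴ * G k) * Vᴴ := by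
          simp only [Matrix.mul_assoc]
      _ = (c k * star (c' k)) • (V * σ * Vᴴ) := by
          rw [h1, h1']
          simp [smul_smul, mul_comm]
      _ = _ := by rw [hρσ]
  have h4 : ∀ y, K (Sum.inr y) * ((∑ k, c k • G k) * σ * (∑ k, c' k • G k)ᴴ) *
      (K (Sum.inr y))ᴴ = 0 := by
    intro y
    simp only [K, Sum.elim_inr]
    rw [← Matrix.mul_assoc, ← Matrix.mul_assoc, Matrix.mul_assoc (single x₀ y (1 : ℂ)) Q, h2]
    simp
  simp only [h3, h4, Finset.sum_const_zero, add_zero, Finset.sum_smul]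

end KnillLaflamme

/-! ### Single insertions and partial traces in terms of Kraus operators -/

section Single

variable {q n : ℕ}

/-- Off-diagonal entries of `σ` give cross terms with two different insertions. This is why
`errorSpan` and the recovery treat `A * M * A'ᴴ` with independent `A` and `A'`. -/
theorem insertAt_eq_sum (p : Fin (n + 1)) (σ : Matrix (Fin q) (Fin q) ℂ) (M : Op q n) :
    insertAt p σ M = ∑ a, ∑ b, σ a b • (insMat p a * M * (insMat p b)ᴴ) := by
  ext x y
  simp only [Matrix.sum_apply, Matrix.smul_apply, mul_conjTranspose_insMat_apply,
    insMat_mul_apply, insertAt, of_apply, smul_eq_mul]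
  simp

theorem traceAt_eq_sum (p : Fin (n + 1)) (M : Op q (n + 1)) :
    traceAt p M = ∑ a : Fin q, (insMat p a)ᴴ * M * insMat p a := by
  ext x y
  simp only [Matrix.sum_apply, mul_insMat_apply, conjTranspose_insMat_mul_apply, traceAt, of_apply]

theorem trace_insertAt (p : Fin (n + 1)) (σ : Matrix (Fin q) (Fin q) ℂ) (M : Op q n) :
    (insertAt p σ M).trace = σ.trace * M.trace := by
  have h : ∀ a b : Fin q, (insMat p a * M * (insMat p b)ᴴ).trace =
      if b = a then M.trace else 0 := by
    intro a b
    rw [Matrix.trace_mul_comm, ← Matrix.mul_assoc, conjTranspose_insMat_mul_insMat]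
    split_ifs <;> simp
  rw [insertAt_eq_sum]
  simp only [trace_sum, trace_smul, h, smul_eq_mul, mul_ite, mul_zero, Finset.sum_ite_eq',
    Finset.mem_univ, if_true]
  rw [← Finset.sum_mul]
  rfl

theorem trace_traceAt (p : Fin (n + 1)) (M : Op q (n + 1)) : (traceAt p M).trace = M.trace := by
  have h : ∀ a : Fin q, ((insMat p a)ᴴ * M * insMat p a).trace =
      (insMat p a * (insMat p a)ᴴ * M).trace := by
    intro a
    rw [Matrix.trace_mul_comm, Matrix.mul_assoc]
  rw [traceAt_eq_sum]
  simp only [trace_sum, h]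
  rw [← trace_sum, ← Matrix.sum_mul, sum_insMat_mul_conjTranspose, Matrix.one_mul]

theorem trace_insertSeq (t : ℕ) (p : (i : Fin t) → Fin (n + i + 1))
    (σ : Fin t → Matrix (Fin q) (Fin q) ℂ) (hσ : ∀ i, (σ i).trace = 1) (M : Op q n) :
    (insertSeq t p σ M).trace = M.trace := by
  induction t with
  | zero => rfl
  | succ t ih =>
    rw [insertSeq]
    refine (trace_insertAt _ _ _).trans ?_
    rw [hσ, one_mul]
    exact ih _ _ fun i => hσ _

theorem trace_traceSeq (t : ℕ) (p : (i : Fin t) → Fin (n + i + 1)) (M : Op q (n + t)) :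
    (traceSeq t p M).trace = M.trace := by
  induction t with
  | zero => rfl
  | succ t ih => exact (ih _ _).trans (trace_traceAt _ _)

/-- The span of the operators `A * M * A'ᴴ`, for `A` and `A'` products prescribed by `w`. -/
def errorSpan (w : List Bool) (m : ℕ) (M : Op q n) : Submodule ℂ (Op q m) :=
  Submodule.span ℂ {X | ∃ A A' : Matrix (Fin m → Fin q) (Fin n → Fin q) ℂ,
    IsMonomial w m n A ∧ IsMonomial w m n A' ∧ X = A * M * A'ᴴ}

theorem mem_errorSpan_nil (M : Op q n) : M ∈ errorSpan [] n M :=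
  Submodule.subset_span ⟨1, 1, .nil n, .nil n, by simp⟩

theorem mul_mul_mem_errorSpan {w w' : List Bool} {m m' : ℕ} {M : Op q n}
    (B B' : Matrix (Fin m' → Fin q) (Fin m → Fin q) ℂ)
    (hB : ∀ A, IsMonomial w m n A → IsMonomial w' m' n (B * A))
    (hB' : ∀ A, IsMonomial w m n A → IsMonomial w' m' n (B' * A))
    {X : Op q m} (hX : X ∈ errorSpan w m M) : B * X * B'ᴴ ∈ errorSpan w' m' M := by
  induction hX using Submodule.span_induction with
  | mem X hX =>
    obtain ⟨A, A', hA, hA', rfl⟩ := hX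
    refine Submodule.subset_span ⟨B * A, B' * A', hB A hA, hB' A' hA', ?_⟩
    rw [conjTranspose_mul]
    simp only [Matrix.mul_assoc]
  | zero => simp
  | add X Y _ _ hX hY =>
    rw [Matrix.mul_add, Matrix.add_mul]
    exact Submodule.add_mem _ hX hY
  | smul c X _ hX =>
    rw [Matrix.mul_smul, Matrix.smul_mul]
    exact Submodule.smul_mem _ c hX

theorem insertAt_mem_errorSpan {w : List Bool} {m : ℕ} {M : Op q n} (p : Fin (m + 1))
    (σ : Matrix (Fin q) (Fin q) ℂ) {X : Op q m} (hX : X ∈ errorSpan w m M) :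
    insertAt p σ X ∈ errorSpan (true :: w) (m + 1) M := by
  rw [insertAt_eq_sum]
  exact Submodule.sum_mem _ fun a _ => Submodule.sum_mem _ fun b _ => Submodule.smul_mem _ _
    (mul_mul_mem_errorSpan _ _ (fun A hA => hA.ins p a) (fun A hA => hA.ins p b) hX)

theorem traceAt_mem_errorSpan {w : List Bool} {m : ℕ} {M : Op q n} (p : Fin (m + 1))
    {X : Op q (m + 1)} (hX : X ∈ errorSpan w (m + 1) M) :
    traceAt p X ∈ errorSpan (false :: w) m M := by
  rw [traceAt_eq_sum]
  refine Submodule.sum_mem _ fun a _ => ?_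
  have := mul_mul_mem_errorSpan _ _ (fun A hA => hA.del p a) (fun A hA => hA.del p a) hX
  rwa [conjTranspose_conjTranspose] at this

theorem insertSeq_mem_errorSpan {w : List Bool} {m : ℕ} {M : Op q n} (t : ℕ)
    (p : (i : Fin t) → Fin (m + i + 1)) (σ : Fin t → Matrix (Fin q) (Fin q) ℂ) {X : Op q m}
    (hX : X ∈ errorSpan w m M) :
    insertSeq t p σ X ∈ errorSpan (List.replicate t true ++ w) (m + t) M := by
  induction t with
  | zero => exact hX
  | succ t ih => exact insertAt_mem_errorSpan _ _ (ih _ _)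

theorem traceSeq_mem_errorSpan {w : List Bool} {m : ℕ} {M : Op q n} (t : ℕ)
    (p : (i : Fin t) → Fin (m + i + 1)) {X : Op q (m + t)} (hX : X ∈ errorSpan w (m + t) M) :
    traceSeq t p X ∈ errorSpan (List.replicate t false ++ w) m M := by
  induction t generalizing w with
  | zero => exact hX
  | succ t ih =>
    rw [List.replicate_succ', List.append_assoc]
    exact ih _ (traceAt_mem_errorSpan _ hX)

end Single

/-! ### Kraus operators of insertions and deletions -/

section Dominates

variable {ι κ l : Type*} [Fintype ι] [Fintype κ] [Fintype l]

theorem Dominates.posSemidef {Φ : Matrix ι ι ℂ → Matrix κ κ ℂ} {E : Matrix κ ι ℂ}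
    (h : Dominates Φ E) {M : Matrix ι ι ℂ} (hM : M.PosSemidef) : (Φ M).PosSemidef := by
  obtain ⟨c, hc, h⟩ := h
  have h1 := (h M hM).add ((hM.mul_mul_conjTranspose_same E).smul (a := (c : ℂ))
    (by exact_mod_cast hc.le))
  rwa [sub_add_cancel] at h1

/-- Linearity of `Ψ` is not needed: apply its bound to `Φ M`, then conjugate the bound for `Φ M` by
`F`. -/
theorem Dominates.comp {Φ : Matrix ι ι ℂ → Matrix κ κ ℂ} {E : Matrix κ ι ℂ}
    {Ψ : Matrix κ κ ℂ → Matrix l l ℂ} {F : Matrix l κ ℂ} (hΨ : Dominates Ψ F)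
    (hΦ : Dominates Φ E) : Dominates (fun M => Ψ (Φ M)) (F * E) := by
  have hpos := fun {M} hM => hΦ.posSemidef (M := M) hM
  obtain ⟨c, hc, hΦ⟩ := hΦ
  obtain ⟨d, hd, hΨ⟩ := hΨ
  refine ⟨d * c, mul_pos hd hc, fun M hM => ?_⟩
  have h1 := (hΨ _ (hpos hM)).add (((hΦ M hM).mul_mul_conjTranspose_same F).smul (a := (d : ℂ))
    (by exact_mod_cast hd.le))
  convert h1 using 1
  rw [Matrix.mul_sub, Matrix.sub_mul, smul_sub, sub_add_sub_cancel]
  congr 1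
  simp only [Matrix.mul_smul, Matrix.smul_mul, smul_smul, conjTranspose_mul, Matrix.mul_assoc]
  push_cast
  rfl

theorem dominates_sum {α : Type*} [Fintype α] {w : α → ℝ} (hw : ∀ a, 0 < w a)
    {Φ : α → Matrix ι ι ℂ → Matrix κ κ ℂ} {E : α → Matrix κ ι ℂ}
    (h : ∀ a, Dominates (Φ a) (E a)) (a : α) :
    Dominates (fun M => ∑ b, (w b : ℂ) • Φ b M) (E a) := by
  classical
  have hpos := fun b {M} hM => ((h b).posSemidef (M := M) hM).smul (a := (w b : ℂ))
    (by exact_mod_cast (hw b).le)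
  obtain ⟨c, hc, ha⟩ := h a
  refine ⟨w a * c, mul_pos (hw a) hc, fun M hM => ?_⟩
  have h1 := ((ha M hM).smul (a := (w a : ℂ)) (by exact_mod_cast (hw a).le)).add
    (posSemidef_sum (Finset.univ.erase a) fun b _ => hpos b hM)
  convert h1 using 1
  beta_reduce
  rw [← Finset.add_sum_erase _ _ (Finset.mem_univ a), smul_sub, smul_smul]
  push_cast
  abel

theorem dominates_sum_kraus {α : Type*} [Fintype α] {w : ℝ} (hw : 0 < w)
    (E : α → Matrix κ ι ℂ) (a : α) :
    Dominates (fun M => ∑ b, (w : ℂ) • (E b * M * (E b)ᴴ)) (E a) :=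
  dominates_sum (w := fun _ => w) (fun _ => hw)
    (fun b => ⟨1, one_pos, fun M _ => by simpa using PosSemidef.zero⟩) a

theorem dominates_id [DecidableEq ι] : Dominates (fun M : Matrix ι ι ℂ => M) 1 :=
  ⟨1, one_pos, fun M _ => by simpa using PosSemidef.zero⟩

end Dominates

section Channels

variable {q n : ℕ}

theorem dominates_insertAt (hq : 0 < q) (p : Fin (n + 1)) (a : Fin q) :
    Dominates (insertAt p ((q : ℂ)⁻¹ • 1)) (insMat p a) := by
  convert dominates_sum_kraus (w := (q : ℝ)⁻¹) (by positivity) (insMat (n := n) p) a using 2 with M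
  rw [insertAt_eq_sum]
  refine Finset.sum_congr rfl fun a _ => ?_
  rw [Finset.sum_eq_single a (by intro b _ hb; simp [one_apply, hb.symm]) (by simp)]
  simp

theorem dominates_traceAt (p : Fin (n + 1)) (a : Fin q) :
    Dominates (traceAt p) (insMat p a)ᴴ := by
  convert dominates_sum_kraus (w := 1) one_pos (fun a => (insMat (n := n) (q := q) p a)ᴴ) a
    using 2 with M
  rw [traceAt_eq_sum]
  simp

theorem dominates_insertSeq (hq : 0 < q) (t : ℕ) (p : (i : Fin t) → Fin (n + i + 1))
    (a : Fin t → Fin q) :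
    Dominates (insertSeq t p fun _ => (q : ℂ)⁻¹ • 1) (insSeqMat t p a) := by
  induction t with
  | zero => exact dominates_id
  | succ t ih =>
    exact (dominates_insertAt hq (n := n + t) (p (Fin.last t)) (a (Fin.last t))).comp (ih _ _)

theorem dominates_traceSeq (t : ℕ) (p : (i : Fin t) → Fin (n + i + 1)) (a : Fin t → Fin q) :
    Dominates (traceSeq t p) (insSeqMat t p a)ᴴ := by
  induction t with
  | zero =>
    rw [insSeqMat, conjTranspose_one]
    exact dominates_id
  | succ t ih =>
    rw [insSeqMat, conjTranspose_mul]
    exact (ih _ _).comp (dominates_traceAt (n := n + t) (p (Fin.last t)) (a (Fin.last t)))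

/-- The maximally mixed state of one qudit. -/
def maximallyMixed (hq : 0 < q) : QuditState q :=
  ⟨(q : ℂ)⁻¹ • 1, PosSemidef.one.smul (by positivity), by
    have : (q : ℂ) ≠ 0 := by exact_mod_cast hq.ne'
    simp [this]⟩

theorem measurable_quditState_apply (i j : Fin q) : Measurable fun σ : QuditState q => σ.1 i j :=
  (measurable_pi_apply (i, j)).comp
    (comap_measurable fun (σ : QuditState q) (ij : Fin q × Fin q) => σ.1 ij.1 ij.2)

theorem measurable_insertSeq (t : ℕ) (p : (i : Fin t) → Fin (n + i + 1)) (M : Op q n)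
    (x y : Fin (n + t) → Fin q) :
    Measurable fun σ : Fin t → QuditState q => insertSeq t p (fun i => (σ i).1) M x y := by
  induction t with
  | zero => exact measurable_const
  | succ t ih =>
    have h1 : Measurable fun σ : Fin (t + 1) → QuditState q => fun i : Fin t => σ i.castSucc :=
      measurable_pi_lambda _ fun i => measurable_pi_apply _
    exact ((measurable_quditState_apply _ _).comp (measurable_pi_apply (Fin.last t))).mul
      ((ih _ _ _).comp h1)

/-- Diagonal entries lie in `[0, 1]`, and the nonnegative `2 × 2` minor bounds `‖σ i j‖ ^ 2` by the
product of two of them. This yields integrability over the inserted states. -/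
theorem norm_apply_le_one (σ : QuditState q) (i j : Fin q) : ‖σ.1 i j‖ ≤ 1 := by
  obtain ⟨σ, hσ, htr⟩ := σ
  have hdiag : ∀ k, ∃ r : ℝ, 0 ≤ r ∧ r ≤ 1 ∧ σ k k = r := by
    intro k
    have h0 : 0 ≤ σ k k := hσ.diag_nonneg
    have h1 : σ k k ≤ 1 := by
      rw [← htr]
      exact Finset.single_le_sum (f := fun k => σ k k) (fun k _ => hσ.diag_nonneg)
        (Finset.mem_univ k)
    rw [Complex.le_def] at h0 h1
    exact ⟨(σ k k).re, h0.1, h1.1, Complex.ext rfl h0.2.symm⟩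
  obtain ⟨a, ha0, ha1, ha⟩ := hdiag i
  obtain ⟨b, hb0, hb1, hb⟩ := hdiag j
  have h := (hσ.submatrix ![i, j]).det_nonneg
  rw [det_fin_two] at h
  simp only [submatrix_apply, cons_val_zero, cons_val_one, ha, hb] at h
  rw [← hσ.isHermitian.apply j i, RCLike.star_def, Complex.mul_conj, Complex.normSq_eq_norm_sq] at h
  have h' : 0 ≤ a * b - ‖σ i j‖ ^ 2 := by exact_mod_cast h
  show ‖σ i j‖ ≤ 1
  nlinarith [norm_nonneg (σ i j), mul_le_mul ha1 hb1 hb0 zero_le_one]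

theorem norm_insertSeq_le (t : ℕ) (p : (i : Fin t) → Fin (n + i + 1)) {M : Op q n} {B : ℝ}
    (hM : ∀ x y, ‖M x y‖ ≤ B) (σ : Fin t → QuditState q) (x y : Fin (n + t) → Fin q) :
    ‖insertSeq t p (fun i => (σ i).1) M x y‖ ≤ B := by
  induction t with
  | zero => exact hM x y
  | succ t ih =>
    refine (norm_mul_le _ _).trans ?_
    have h1 := ih (fun i => p i.castSucc) (fun i => σ i.castSucc)
      ((p (Fin.last t)).removeNth x) ((p (Fin.last t)).removeNth y)
    calc _ ≤ 1 * B := mul_le_mul (norm_apply_le_one _ _ _) h1 (norm_nonneg _) zero_le_one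
      _ = B := one_mul B

theorem sum_inv_card {α : Type*} [Fintype α] [Nonempty α] :
    ∑ _a : α, (Fintype.card α : ℝ)⁻¹ = 1 := by
  simp

/-- The channel inserting maximally mixed qudits at a uniformly random position set. -/
theorem exists_isInsertionChannel_dominates (hq : 0 < q) (t : ℕ) (P₀ : PosSet n t) :
    ∃ Φ : Op q n → Op q (n + t), IsInsertionChannel n t Φ ∧
      ∀ (P : PosSet n t) (a : Fin t → Fin q), Dominates Φ (insSeqMat t P.pos a) := by
  have : Nonempty (PosSet n t) := ⟨P₀⟩
  refine ⟨fun M => ∑ P, (((Fintype.card (PosSet n t) : ℝ)⁻¹ : ℝ) : ℂ) •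
    insertion P (fun _ => maximallyMixed hq) M,
    ⟨Measure.dirac fun _ => maximallyMixed hq, fun _ _ => (Fintype.card (PosSet n t) : ℝ)⁻¹,
      inferInstance, fun _ => measurable_const, fun _ _ => by positivity,
      fun _ => sum_inv_card, fun M x y => ?_⟩, fun P a => ?_⟩
  · rw [integral_dirac']
    · simp only [Matrix.sum_apply, Matrix.smul_apply, smul_eq_mul]
    · exact (Finset.measurable_sum _ fun P _ =>
        (measurable_insertSeq t P.pos M x y).const_mul _).stronglyMeasurable
  · exact dominates_sum (w := fun _ : PosSet n t => (Fintype.card (PosSet n t) : ℝ)⁻¹)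
      (fun _ => by positivity) (fun Q => dominates_insertSeq hq t Q.pos a) P

/-- The channel erasing a uniformly random position set. -/
theorem exists_isDeletionChannel_dominates (t : ℕ) (P₀ : PosSet n t) :
    ∃ Φ : Op q (n + t) → Op q n, IsDeletionChannel n t Φ ∧
      ∀ (P : PosSet n t) (a : Fin t → Fin q), Dominates Φ (insSeqMat t P.pos a)ᴴ := by
  have : Nonempty (PosSet n t) := ⟨P₀⟩
  refine ⟨fun M => ∑ P, (((Fintype.card (PosSet n t) : ℝ)⁻¹ : ℝ) : ℂ) • erasure P M,
    ⟨fun _ => (Fintype.card (PosSet n t) : ℝ)⁻¹, fun _ => by positivity, sum_inv_card,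
      fun _ => rfl⟩, fun P a => ?_⟩
  exact dominates_sum (w := fun _ : PosSet n t => (Fintype.card (PosSet n t) : ℝ)⁻¹)
    (fun _ => by positivity) (fun Q => dominates_traceSeq t Q.pos a) P

end Channels

/-! ### Insdel codes and the Knill-Laflamme conditions -/

section Codes

variable {q : ℕ}

/-- `Φ` is an insdel channel: `t₂` deletions that leave `n` qudits, and `t₁` insertions. -/
def IsInsdelChannelOn {N : ℕ} (n t₁ t₂ : ℕ) (h : n + t₂ = N) (Φ : Op q N → Op q (n + t₁)) : Prop :=
  ∃ (del : Op q (n + t₂) → Op q n) (ins : Op q n → Op q (n + t₁)),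
    IsDeletionChannel n t₂ del ∧ IsInsertionChannel n t₁ ins ∧
    ∀ M : Op q N, Φ M = ins (del (relabel h.symm M))

theorem relabel_rfl {n : ℕ} (M : Op q n) : relabel rfl M = M := rfl

/-- One channel suffices: uniformly random erasure followed by maximally mixed insertions at
uniformly random positions dominates every sorted error, hence both halves of any word. -/
theorem wordIn_scalarOn_of_forall_corrects (hq : 0 < q) {N n t₁ t₂ : ℕ} (h : n + t₂ = N)
    {C : Submodule ℂ ((Fin N → Fin q) → ℂ)}
    (hC : ∀ Φ : Op q N → Op q (n + t₁), IsInsdelChannelOn n t₁ t₂ h Φ → Corrects C Φ) :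
    WordIn (scalarOn C) (insdelWord t₁ t₂) := by
  subst h
  intro A hA
  obtain ⟨k₁, A₁, A', hA₁, hA', rfl⟩ := hA.exists_of_append
  obtain ⟨k₂, A₂, A'', hA₂, hA'', rfl⟩ := hA'.exists_of_append
  obtain ⟨k₃, A₃, A₄, hA₃, hA₄, rfl⟩ := hA''.exists_of_append
  have l₁ := hA₁.level
  have l₃ := hA₃.level
  have l₄ := hA₄.level
  simp [List.count_replicate] at l₁ l₃ l₄
  subst l₁ l₄ l₃
  obtain ⟨P₁, a₁, rfl⟩ := hA₁.exists_eq_insSeqMat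
  obtain ⟨P₂, a₂, h₂⟩ := hA₂.conjTranspose_replicate_false.exists_eq_insSeqMat
  obtain ⟨P₃, a₃, rfl⟩ := hA₃.exists_eq_insSeqMat
  obtain ⟨P₄, a₄, h₄⟩ := hA₄.conjTranspose_replicate_false.exists_eq_insSeqMat
  obtain ⟨ins, hins, dins⟩ := exists_isInsertionChannel_dominates hq t₁ P₂
  obtain ⟨del, hdel, ddel⟩ := exists_isDeletionChannel_dominates (q := q) t₂ P₁
  have key := conjTranspose_mul_mem_scalarOn
    (hC (fun M => ins (del M)) ⟨del, ins, hdel, hins, fun _ => rfl⟩)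
    ((dins P₂ a₂).comp (ddel P₁ a₁)) ((dins P₃ a₃).comp (ddel P₄ a₄))
  rw [← h₂, ← h₄] at key
  simpa [Matrix.mul_assoc] using key

theorem conjTranspose_mul_mem_of_mem_span {N m : ℕ} {G : Submodule ℂ (Op q N)} {t₁ t₂ : ℕ}
    (hG : WordIn G (insdelWord t₁ t₂)) {E E' : Matrix (Fin m → Fin q) (Fin N → Fin q) ℂ}
    (hE : E ∈ Submodule.span ℂ
      {A | IsMonomial (List.replicate t₁ true ++ List.replicate t₂ false) m N A})
    (hE' : E' ∈ Submodule.span ℂ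
      {A | IsMonomial (List.replicate t₁ true ++ List.replicate t₂ false) m N A}) :
    Eᴴ * E' ∈ G := by
  induction hE using Submodule.span_induction with
  | mem A hA =>
    induction hE' using Submodule.span_induction with
    | mem A' hA' =>
      obtain ⟨k, B, D, hB, hD, rfl⟩ := IsMonomial.exists_of_append hA
      rw [conjTranspose_mul, Matrix.mul_assoc]
      exact hG _ (hD.conjTranspose_replicate_false.append
        (hB.conjTranspose_replicate_true.append hA'))
    | zero => simp
    | add X Y _ _ hX hY =>
      rw [Matrix.mul_add]
      exact G.add_mem hX hY
    | smul c X _ hX =>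
      rw [Matrix.mul_smul]
      exact G.smul_mem c hX
  | zero => simp
  | add X Y _ _ hX hY =>
    rw [conjTranspose_add, Matrix.add_mul]
    exact G.add_mem hX hY
  | smul c X _ hX =>
    rw [conjTranspose_smul, Matrix.smul_mul]
    exact G.smul_mem _ hX

/-- A finite combination of entries of `X`, so that `R` can be exchanged with an entrywise integral.
-/
theorem linearMap_matrix_apply {ι κ : Type*} [Fintype κ] [DecidableEq κ]
    (R : Matrix κ κ ℂ →ₗ[ℂ] Matrix ι ι ℂ) (X : Matrix κ κ ℂ) (i j : ι) :
    R X i j = ∑ x, ∑ y, X x y * R (single x y 1) i j := by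
  conv_lhs => rw [matrix_eq_sum_single X]
  simp only [map_sum, Matrix.sum_apply]
  refine Finset.sum_congr rfl fun x _ => Finset.sum_congr rfl fun y _ => ?_
  have h1 : single x y (X x y) = X x y • single x y (1 : ℂ) := by simp
  rw [h1, map_smul, Matrix.smul_apply, smul_eq_mul]

/-- For each inserted product state the output lies in the span of the `E * ρ * E'ᴴ`, so the
recovery returns a multiple of `ρ`. Traces force the multiple to be `1`, whatever the probabilities,
and integration over the states preserves this. -/
theorem corrects_of_wordIn_scalarOn (hq : 0 < q) {N n t₁ t₂ : ℕ} (h : n + t₂ = N)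
    {C : Submodule ℂ ((Fin N → Fin q) → ℂ)} (hC : WordIn (scalarOn C) (insdelWord t₁ t₂))
    {Φ : Op q N → Op q (n + t₁)} (hΦ : IsInsdelChannelOn n t₁ t₂ h Φ) : Corrects C Φ := by
  subst h
  have : NeZero q := ⟨hq.ne'⟩
  obtain ⟨del, ins, ⟨w, hw0, hw1, hdel⟩, ⟨μ, p, hμ, hpm, hp0, hp1, hins⟩, hΦ⟩ := hΦ
  obtain ⟨R, hR, hRE⟩ := exists_recovery C
    (Submodule.span ℂ {A : Matrix (Fin (n + t₁) → Fin q) (Fin (n + t₂) → Fin q) ℂ |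
      IsMonomial (List.replicate t₁ true ++ List.replicate t₂ false) (n + t₁) (n + t₂) A})
    (fun E hE E' hE' => conjTranspose_mul_mem_of_mem_span hC hE hE')
  refine ⟨R, hR, fun ρ hρ hs => ?_⟩
  set τ := del ρ with hτ
  have hτmem : τ ∈ errorSpan (List.replicate t₂ false ++ []) n ρ := by
    rw [hτ, hdel]
    exact Submodule.sum_mem _ fun P _ => Submodule.smul_mem _ _
      (traceSeq_mem_errorSpan _ _ (mem_errorSpan_nil ρ))
  have hτtr : τ.trace = 1 := by
    rw [hτ, hdel, trace_sum]
    have : ∀ P : PosSet n t₂, (erasure P ρ).trace = 1 := fun P =>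
      (trace_traceSeq _ _ _).trans hρ.2
    simp only [trace_smul, this, smul_eq_mul, mul_one]
    exact_mod_cast hw1
  set Ψ : (Fin t₁ → QuditState q) → Op q (n + t₁) := fun σ =>
    ∑ P, (p σ P : ℂ) • insertion P σ τ with hΨ
  have hRΨ : ∀ σ, R (Ψ σ) = ρ := by
    intro σ
    have hmem : Ψ σ ∈ errorSpan (List.replicate t₁ true ++ (List.replicate t₂ false ++ []))
        (n + t₁) ρ :=
      Submodule.sum_mem _ fun P _ => Submodule.smul_mem _ _ (insertSeq_mem_errorSpan _ _ _ hτmem)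
    have htr : (Ψ σ).trace = 1 := by
      have : ∀ P : PosSet n t₁, (insertion P σ τ).trace = 1 := fun P =>
        (trace_insertSeq _ _ _ (fun i => (σ i).2.2) _).trans hτtr
      simp only [hΨ, trace_sum, trace_smul, this, smul_eq_mul, mul_one]
      exact_mod_cast hp1 σ
    have hle : errorSpan (List.replicate t₁ true ++ (List.replicate t₂ false ++ []))
        (n + t₁) ρ ≤ (Submodule.span ℂ {ρ}).comap R := by
      refine Submodule.span_le.2 ?_
      rintro _ ⟨A, A', hA, hA', rfl⟩
      rw [List.append_nil] at hA hA'
      obtain ⟨c, hc⟩ := hRE A (Submodule.subset_span hA) A' (Submodule.subset_span hA') ρ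
        hρ.1.isHermitian hs
      exact (Submodule.mem_span_singleton (R := ℂ)).2 ⟨c, hc.symm⟩
    obtain ⟨c, hc⟩ := Submodule.mem_span_singleton.1 (hle hmem)
    have h1 := hR.2 (Ψ σ)
    rw [← hc, htr, trace_smul, hρ.2, smul_eq_mul, mul_one] at h1
    rw [← hc, h1, one_smul]
  have hint : ∀ x y, Integrable (fun σ => Ψ σ x y) μ := by
    intro x y
    simp only [hΨ, Matrix.sum_apply, Matrix.smul_apply, smul_eq_mul]
    refine integrable_finsetSum _ fun P _ => ?_
    have hB : ∀ u v, ‖τ u v‖ ≤ ∑ u, ∑ v, ‖τ u v‖ := fun u v =>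
      (Finset.single_le_sum (f := fun v => ‖τ u v‖) (fun _ _ => norm_nonneg _)
        (Finset.mem_univ v)).trans
      (Finset.single_le_sum (f := fun u => ∑ v, ‖τ u v‖)
        (fun _ _ => Finset.sum_nonneg fun _ _ => norm_nonneg _) (Finset.mem_univ u))
    refine Integrable.of_bound (C := 1 * ∑ u, ∑ v, ‖τ u v‖)
      ((Complex.measurable_ofReal.comp (hpm P)).mul
        (measurable_insertSeq _ _ _ _ _)).aestronglyMeasurable (Filter.Eventually.of_forall ?_)
    intro σ
    rw [norm_mul]
    refine mul_le_mul ?_ (norm_insertSeq_le _ _ hB _ _ _) (norm_nonneg _) zero_le_one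
    rw [Complex.norm_real, Real.norm_of_nonneg (hp0 σ P), ← hp1 σ]
    exact Finset.single_le_sum (fun P _ => hp0 σ P) (Finset.mem_univ P)
  have hΦρ : ∀ x y, Φ ρ x y = ∫ σ, Ψ σ x y ∂μ := by
    intro x y
    rw [hΦ, relabel_rfl, hins]
    simp only [hΨ, Matrix.sum_apply, Matrix.smul_apply, smul_eq_mul, hτ]
  ext i j
  calc R (Φ ρ) i j = ∑ x, ∑ y, ∫ σ, Ψ σ x y * R (single x y 1) i j ∂μ := by
        rw [linearMap_matrix_apply]
        simp only [hΦρ, integral_mul_const]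
    _ = ∫ σ, ∑ x, ∑ y, Ψ σ x y * R (single x y 1) i j ∂μ := by
        rw [integral_finsetSum _ fun x _ => integrable_finsetSum _ fun y _ =>
          (hint x y).mul_const _]
        exact Finset.sum_congr rfl fun x _ => (integral_finsetSum _ fun y _ =>
          (hint x y).mul_const _).symm
    _ = ∫ _σ, ρ i j ∂μ := by simp only [← linearMap_matrix_apply, hRΨ]
    _ = ρ i j := by simp

end Codes

end Insdel

end

theorem theorem2p5 (q : ℕ) (hq : 2 ≤ q) (N t₁ t₂ s₁ s₂ : ℕ) (ht : t₂ < N) (hs : s₂ < N)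
    (hsum : t₁ + t₂ = s₁ + s₂) (C : Submodule ℂ ((Fin N → Fin q) → ℂ))
    (hC : Insdel.IsInsdelCode C t₁ t₂ ht) : Insdel.IsInsdelCode C s₁ s₂ hs := by
  intro Φ hΦ
  -- `IsInsdelChannel` is by definition `IsInsdelChannelOn` with `n = N - t₂`.
  have h := Insdel.wordIn_scalarOn_of_forall_corrects (by omega) (Nat.sub_add_cancel ht.le) hC
  rw [Insdel.wordIn_insdelWord_iff_zero ht.le, hsum,
    ← Insdel.wordIn_insdelWord_iff_zero hs.le] at h
  exact Insdel.corrects_of_wordIn_scalarOn (by omega) (Nat.sub_add_cancel hs.le) h hΦ
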